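/- For a finite simple graph $G$ of order $n(G)$, let $$C(G)=\frac{1}{n(G)}\sum_{u\in V(G)}C_u(G),\qquad C_u(G)=\begin{cases}\dfrac{m(G[N_G(u)])}{\binom{d_G(u)}{2}}, & d_G(u)\ge 2,\\[2mm] 0, & \text{otherwise,}\end{cases}$$ be its clustering coefficient, where $m(G[N_G(u)])$ is the number of edges of the subgraph of $G$ induced by the neighborhood $N_G(u)$ of $u$. A graph is subcubic if all its vertices have degree at most $3$. The diamond is $K_4$ minus one edge. A block is a maximal connected subgraph that has no cut vertex of its own; an endblock of a connected graph is a block that contains at most one cut vertex of that graph. Let $\mathcal{B}_0$ be the set of all connected subcubic graphs $G$ of order at least $6$ such that every block of $G$ is $K_2$, $K_3$, or a diamond, every block of $G$ that is a diamond is an endblock of $G$, and every vertex of $G$ of degree at most $2$ lies in a triangle. The type of a graph $G\in\mathcal{B}_0$ is $t(G)=(d,i_2,i_3)$, where $d$ is the number of blocks of $G$ that are diamonds and, for $j\in\{2,3\}$, $i_j$ is the number of blocks of $G$ that are triangles containing exactly $j$ vertices of degree $3$ in $G$. Let $$\mathcal{B}=\big\{G\in\mathcal{B}_0 : t(G)\in\{(0,0,0),(1,0,0),(0,1,0),(0,0,1),(0,1,1),(0,2,0),(0,3,0)\}\big\}.$$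 Theorem. If $G$ is a connected subcubic graph of order $n\ge 6$, then $$C(G)=\begin{cases}\frac{7}{12}+\frac{12}{12n}, & n\equiv 0 \bmod 4,\\[1mm] \frac{7}{12}+\frac{13}{12n}, & n\equiv 1 \bmod 4,\\[1mm] \frac{7}{12}+\frac{14}{12n}, & n\equiv 2 \bmod 4,\\[1mm] \frac{7}{12}+\frac{11}{12n}, & n\equiv 3 \bmod 4,\end{cases}$$ if and only if $G\in\mathcal{B}$. -/

import Mathlib

namespace Clustering

/-- The clustering coefficient `C_u(G)` of a vertex `u`: the number of edges of the subgraph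
induced by the neighborhood of `u`, divided by `d(u).choose 2`, if `d(u) ≥ 2`; otherwise `0`. -/
noncomputable def vertexCoeff {V : Type*} [Fintype V] (G : SimpleGraph V) [DecidableRel G.Adj] (u : V) : ℚ :=
  if 2 ≤ G.degree u then
    ((G.induce (G.neighborSet u)).edgeSet.ncard : ℚ) / ((G.degree u).choose 2 : ℚ)
  else 0

/-- The clustering coefficient `C(G)`: the average of the clustering coefficients of the vertices. -/
noncomputable def coeff {V : Type*} [Fintype V] (G : SimpleGraph V) [DecidableRel G.Adj] : ℚ :=
  1 / (Fintype.card V : ℚ) * ∑ u : V, vertexCoeff G u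

/-- The value of the upper bound on the clustering coefficient of a connected subcubic graph
of order `n`. -/
def bound (n : ℕ) : ℚ :=
  if n % 4 = 0 then 7 / 12 + 12 / (12 * (n : ℚ))
  else if n % 4 = 1 then 7 / 12 + 13 / (12 * (n : ℚ))
  else if n % 4 = 2 then 7 / 12 + 14 / (12 * (n : ℚ))
  else 7 / 12 + 11 / (12 * (n : ℚ))

/-- Every vertex has degree at most `3`. -/
def IsSubcubic {V : Type*} [Fintype V] (G : SimpleGraph V) [DecidableRel G.Adj] : Prop :=
  ∀ v : V, G.degree v ≤ 3

/-- The diamond: `K_4` minus one edge. -/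
def diamond : SimpleGraph (Fin 4) := (⊤ : SimpleGraph (Fin 4)).deleteEdges {s(0, 1)}

/-- A connected subgraph that has no cut vertex of its own. -/
def IsNonseparable {V : Type*} {G : SimpleGraph V} (B : G.Subgraph) : Prop :=
  B.Connected ∧ ∀ v ∈ B.verts, (B.deleteVerts {v}).Preconnected

/-- A block of `G`: a maximal connected subgraph without a cut vertex of its own. -/
def IsBlock {V : Type*} {G : SimpleGraph V} (B : G.Subgraph) : Prop :=
  Maximal IsNonseparable B

/-- A cut vertex of a (connected) graph: deleting it leaves a disconnected graph. -/
def IsCutVertex {V : Type*} (G : SimpleGraph V) (v : V) : Prop :=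
  ¬ (G.induce {v}ᶜ).Preconnected

/-- An endblock of a connected graph: a block that contains at most one of its cut vertices. -/
def IsEndblock {V : Type*} {G : SimpleGraph V} (B : G.Subgraph) : Prop :=
  IsBlock B ∧ {v : V | v ∈ B.verts ∧ IsCutVertex G v}.Subsingleton

/-- The subgraph `B` is a copy of `K_2`. -/
def IsK2 {V : Type*} {G : SimpleGraph V} (B : G.Subgraph) : Prop :=
  Nonempty (B.coe ≃g (⊤ : SimpleGraph (Fin 2)))

/-- The subgraph `B` is a triangle. -/
def IsK3 {V : Type*} {G : SimpleGraph V} (B : G.Subgraph) : Prop :=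
  Nonempty (B.coe ≃g (⊤ : SimpleGraph (Fin 3)))

/-- The subgraph `B` is a diamond. -/
def IsDiamond {V : Type*} {G : SimpleGraph V} (B : G.Subgraph) : Prop :=
  Nonempty (B.coe ≃g diamond)

/-- The number of blocks of `G` that are diamonds. -/
noncomputable def numDiamondBlocks {V : Type*} (G : SimpleGraph V) : ℕ :=
  {B : G.Subgraph | IsBlock B ∧ IsDiamond B}.ncard

/-- The number of blocks of `G` that are triangles containing exactly `j` vertices of
degree `3` in `G`. -/
noncomputable def numTriangleBlocks {V : Type*} [Fintype V] (G : SimpleGraph V)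
    [DecidableRel G.Adj] (j : ℕ) : ℕ :=
  {B : G.Subgraph | IsBlock B ∧ IsK3 B ∧ {v : V | v ∈ B.verts ∧ G.degree v = 3}.ncard = j}.ncard

/-- The type `(d, i₂, i₃)` of a graph. -/
noncomputable def graphType {V : Type*} [Fintype V] (G : SimpleGraph V) [DecidableRel G.Adj] :
    ℕ × ℕ × ℕ :=
  (numDiamondBlocks G, numTriangleBlocks G 2, numTriangleBlocks G 3)

/-- The vertex `v` lies in some triangle of `G`. -/
def InTriangle {V : Type*} (G : SimpleGraph V) (v : V) : Prop :=
  ∃ x y : V, G.Adj v x ∧ G.Adj v y ∧ G.Adj x y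

/-- The class `𝓑₀`: connected subcubic graphs of order at least `6` all of whose blocks are
`K_2`, `K_3`, or diamonds that are endblocks, and in which no vertex of degree at most `2`
lies outside all triangles. -/
structure MemB0 {V : Type*} [Fintype V] (G : SimpleGraph V) [DecidableRel G.Adj] : Prop where
  connected : G.Connected
  subcubic : IsSubcubic G
  order : 6 ≤ Fintype.card V
  blocks : ∀ B : G.Subgraph, IsBlock B → IsK2 B ∨ IsK3 B ∨ IsDiamond B
  diamonds : ∀ B : G.Subgraph, IsBlock B → IsDiamond B → IsEndblock B
  inTriangle : ∀ v : V, G.degree v ≤ 2 → InTriangle G v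

/-- The class `𝓑`: the graphs in `𝓑₀` whose type is one of seven triples. -/
def MemB {V : Type*} [Fintype V] (G : SimpleGraph V) [DecidableRel G.Adj] : Prop :=
  MemB0 G ∧ graphType G ∈
    ({(0, 0, 0), (1, 0, 0), (0, 1, 0), (0, 0, 1), (0, 1, 1), (0, 2, 0), (0, 3, 0)} :
      Set (ℕ × ℕ × ℕ))

end Clustering

namespace Clustering

open SimpleGraph

/-! ### Components of a spanning subgraph versus the edges outside it -/

section Components

variable {V : Type*} {G T : SimpleGraph V}

/-! Let T be the graph of the edges of G that lie in triangles, c the number of components of T, and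
m the number of edges outside T. Contracting the components of T leaves a connected graph, so c ≤ m
+ 1, with equality exactly when every edge outside T is a bridge (`card_connectedComponent_le`,
`isBridge_of_card_connectedComponent`, `card_edgeSet_sdiff_add_one_le`).

Give a vertex u the weight 12 C_u - 7 + 7 deg_{G - E(T)}(u), and a component of T the sum of its
vertex weights minus 14. Summation gives 12 ∑ C_u - 7n = 14 (c - m) + ∑ (component weights)
(`sum_vertexCoeff_eq`). For order at least 6 the components are single vertices, triangles and
diamonds. Their weights are 7 deg - 21, 1 - j and -j, where j counts the cubic vertices in the
component (`IsSubcubic.componentWeight_cases`). Connectivity forces j ≥ 1 in a triangle, so all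
weights are nonpositive and the excess 12 ∑ C_u - 7n is at most 14.

An excess of at least 11 forces c = m + 1 and all weights ≥ -3, which amounts to membership in 𝓑₀
once blocks are matched with bridges and components of T (`IsSubcubic.memB0_iff`). In 𝓑₀ the excess
is 14 - (3d + i₂ + 2i₃), and the seven types are the solutions of 3d + i₂ + 2i₃ ≤ 3. Finally, 3 C_u
is an integer, so the excess is an integer congruent to n modulo 4. The window 11, ..., 14 holds
exactly one such integer, and it is the one prescribed by the bound. -/

/-- Contracting the components of a graph keeps a connected graph connected. -/
theorem connected_map_connectedComponentMk (hG : G.Connected) (T : SimpleGraph V) :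
    (G.map T.connectedComponentMk).Connected := by
  have := hG.nonempty
  have : Nonempty T.ConnectedComponent := ⟨T.connectedComponentMk (Classical.arbitrary V)⟩
  refine ⟨fun c d => ?_⟩
  induction c using ConnectedComponent.ind with | _ u
  induction d using ConnectedComponent.ind with | _ v
  obtain ⟨p⟩ := hG.preconnected u v
  induction p with
  | nil => exact Reachable.refl _
  | @cons a b c hab p ih =>
    refine Reachable.trans ?_ ih
    by_cases h : T.connectedComponentMk a = T.connectedComponentMk b
    · rw [h]
    · exact (map_adj_apply' hab h).reachable

/-- A connected graph has at most one more vertex than edges. This is applied to the contracted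
graph, whose edges are all images of edges outside `T`. -/
theorem card_connectedComponent_le [Finite V] (hG : G.Connected) (T : SimpleGraph V) :
    Nat.card T.ConnectedComponent ≤ (G \ T).edgeSet.ncard + 1 := by
  refine (connected_map_connectedComponentMk hG T).card_vert_le_card_edgeSet_add_one.trans ?_
  gcongr
  rw [Nat.card_coe_set_eq]
  refine (Set.ncard_le_ncard ?_ (Set.toFinite _)).trans
    (Set.ncard_image_le (f := Sym2.map T.connectedComponentMk) (Set.toFinite _))
  intro e he
  induction e with | h c d
  rw [mem_edgeSet, map_adj'] at he
  obtain ⟨hne, u, v, huv, rfl, rfl⟩ := he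
  refine ⟨s(u, v), ?_, by simp⟩
  rw [mem_edgeSet, sdiff_adj]
  exact ⟨huv, fun h => hne (ConnectedComponent.sound h.reachable)⟩

/-- If the graph obtained by contracting the components of `T` is a tree, then every edge of `G`
outside `T` is a bridge. -/
theorem isBridge_of_card_connectedComponent [Finite V] (hG : G.Connected)
    (h : (G \ T).edgeSet.ncard + 1 ≤ Nat.card T.ConnectedComponent) {u v : V}
    (huv : (G \ T).Adj u v) : G.IsBridge s(u, v) := by
  by_contra hb
  have h1 := card_connectedComponent_le (hG.connected_delete_edge_of_not_isBridge hb) T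
  have h2 : ((G.deleteEdges {s(u, v)}) \ T).edgeSet.ncard < (G \ T).edgeSet.ncard := by
    refine Set.ncard_lt_ncard ?_ (Set.toFinite _)
    refine (Set.ssubset_iff_of_subset ?_).2 ⟨s(u, v), huv, ?_⟩
    · rw [edgeSet_subset_edgeSet]
      exact sdiff_le_sdiff_right (deleteEdges_le _)
    · simp
  omega

/-- Induction on the number of edges outside `T`. Moving such an edge into `T` merges two
components: if its ends were already joined in `T`, they would stay joined after deleting the edge
from `G`, and it would not be a bridge. -/
theorem card_edgeSet_sdiff_add_one_le [Finite V] (hG : G.Connected) :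
    ∀ {T : SimpleGraph V}, (∀ u v, (G \ T).Adj u v → G.IsBridge s(u, v)) → T ≤ G →
      (G \ T).edgeSet.ncard + 1 ≤ Nat.card T.ConnectedComponent := by
  intro T
  induction hn : (G \ T).edgeSet.ncard generalizing T with
  | zero =>
    intro _ _
    have := hG.nonempty
    have : Nonempty T.ConnectedComponent := ⟨T.connectedComponentMk (Classical.arbitrary V)⟩
    have : 0 < Nat.card T.ConnectedComponent := Nat.card_pos
    omega
  | succ n ih =>
    intro hb hT
    obtain ⟨e, he⟩ : (G \ T).edgeSet.Nonempty :=
      (Set.ncard_pos (Set.toFinite _)).1 (by omega)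
    induction e with | h u v
    have huv : (G \ T).Adj u v := he
    have hle : T ≤ T ⊔ edge u v := le_sup_left
    have hedge : edge u v ≤ G := by
      rw [edge_le_iff]; exact Or.inr huv.1
    have hset : (G \ (T ⊔ edge u v)).edgeSet = (G \ T).edgeSet \ {s(u, v)} := by
      rw [edgeSet_sdiff, edgeSet_sup, edgeSet_edge_of_ne huv.ne, edgeSet_sdiff, Set.sdiff_sdiff]
    have hcard : (G \ (T ⊔ edge u v)).edgeSet.ncard = n := by
      rw [hset, Set.ncard_sdiff_singleton_of_mem he, hn]; rfl
    have h1 := ih hcard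
      (fun a b hab => hb a b ⟨hab.1, fun h => hab.2 (hle h)⟩) (sup_le hT hedge)
    have h2 : Nat.card (T ⊔ edge u v).ConnectedComponent < Nat.card T.ConnectedComponent := by
      have := Fintype.ofFinite T.ConnectedComponent
      have := Fintype.ofFinite (T ⊔ edge u v).ConnectedComponent
      rw [Nat.card_eq_fintype_card, Nat.card_eq_fintype_card]
      refine Fintype.card_lt_of_surjective_not_injective _
        (ConnectedComponent.surjective_map_ofLE hle) fun hinj => ?_
      have hr : T.Reachable u v := by
        refine ConnectedComponent.exact (hinj ?_)
        refine ConnectedComponent.sound (Adj.reachable ?_)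
        simp [edge_adj, huv.ne]
      refine (isBridge_iff.1 (hb u v huv)) (hr.mono fun a b hab => ?_)
      rw [deleteEdges_adj]
      refine ⟨hT hab, fun h => huv.2 ?_⟩
      have : s(a, b) ∈ T.edgeSet := hab
      rwa [Set.mem_singleton_iff.1 h] at this
    omega

end Components

/-! ### The triangle graph and the shapes of its components -/

section TriangleGraph

variable {V : Type*}

/-- The graph formed by the edges of `G` that lie in a triangle of `G`. -/
def triangleGraph (G : SimpleGraph V) : SimpleGraph V where
  Adj u v := G.Adj u v ∧ ∃ w, G.Adj u w ∧ G.Adj v w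
  symm := ⟨fun _ _ ⟨h, w, h1, h2⟩ => ⟨h.symm, w, h2, h1⟩⟩
  loopless := ⟨fun _ h => h.1.ne rfl⟩

variable {G : SimpleGraph V}

theorem triangleGraph_le : triangleGraph G ≤ G := fun _ _ h => h.1

theorem triangleGraph_adj_of_triangle {a b c : V} (hab : G.Adj a b) (hbc : G.Adj b c)
    (hac : G.Adj a c) : (triangleGraph G).Adj a b :=
  ⟨hab, c, hac, hbc⟩

theorem supp_connectedComponentMk_eq {T : SimpleGraph V} {v : V} {S : Set V} (hv : v ∈ S)
    (hS : ∀ w ∈ S, T.Reachable v w) (hcl : ∀ w ∈ S, ∀ z, T.Adj w z → z ∈ S) :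
    (T.connectedComponentMk v).supp = S := by
  ext w
  rw [ConnectedComponent.mem_supp_iff, ConnectedComponent.eq]
  refine ⟨fun ⟨p⟩ => ?_, fun h => (hS w h).symm⟩
  have key : ∀ a b, T.Walk a b → b ∈ S → a ∈ S := by
    intro a b p hb
    induction p with
    | nil => exact hb
    | cons h p ih => exact hcl _ (ih hb) _ h.symm
  exact key _ _ p hv

variable [Fintype V] [DecidableRel G.Adj]

theorem IsSubcubic.eq_or_eq_or_eq (hsub : IsSubcubic G) {v a b c z : V} (ha : G.Adj v a)
    (hb : G.Adj v b) (hc : G.Adj v c) (hab : a ≠ b) (hac : a ≠ c) (hbc : b ≠ c)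
    (hz : G.Adj v z) : z = a ∨ z = b ∨ z = c := by
  classical
  by_contra! h
  have h1 : ({z, a, b, c} : Finset V) ⊆ G.neighborFinset v := by
    intro w hw
    simp only [Finset.mem_insert, Finset.mem_singleton] at hw
    rw [mem_neighborFinset]
    rcases hw with rfl | rfl | rfl | rfl <;> assumption
  have h2 := Finset.card_le_card h1
  rw [card_neighborFinset_eq_degree] at h2
  have h3 : ({z, a, b, c} : Finset V).card = 4 := by
    rw [Finset.card_eq_succ]
    refine ⟨z, {a, b, c}, by simp [h], rfl, ?_⟩
    rw [Finset.card_eq_three]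
    exact ⟨a, b, c, hab, hac, hbc, rfl⟩
  have := hsub v
  omega

/-- Otherwise the four vertices form a `K_4`, which uses up all their degrees and is therefore the
whole connected graph, contrary to the order. -/
theorem IsSubcubic.not_adj_of_diamond (hsub : IsSubcubic G) (hconn : G.Connected)
    (hcard : 6 ≤ Fintype.card V) {x y h k : V} (hhk : G.Adj h k) (hhx : G.Adj h x)
    (hhy : G.Adj h y) (hkx : G.Adj k x) (hky : G.Adj k y) (hne : x ≠ y) : ¬ G.Adj x y := by
  classical
  intro hxy
  have hs : (G.connectedComponentMk x).supp = ({x, y, h, k} : Set V) := by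
    refine supp_connectedComponentMk_eq (by simp) (fun w _ => hconn.preconnected x w) ?_
    intro w hw z hz
    simp only [Set.mem_insert_iff, Set.mem_singleton_iff] at hw ⊢
    rcases hw with rfl | rfl | rfl | rfl
    · have := hsub.eq_or_eq_or_eq hxy hhx.symm hkx.symm hhy.ne.symm hky.ne.symm hhk.ne hz
      tauto
    · have := hsub.eq_or_eq_or_eq hxy.symm hhy.symm hky.symm hhx.ne.symm hkx.ne.symm hhk.ne hz
      tauto
    · have := hsub.eq_or_eq_or_eq hhx hhy hhk hne hkx.ne.symm hky.ne.symm hz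
      tauto
    · have := hsub.eq_or_eq_or_eq hkx hky hhk.symm hne hhx.ne.symm hhy.ne.symm hz
      tauto
  have hu : (Finset.univ : Finset V) ⊆ {x, y, h, k} := by
    intro w _
    have : w ∈ (G.connectedComponentMk x).supp := by
      rw [ConnectedComponent.mem_supp_iff, ConnectedComponent.eq]
      exact hconn.preconnected w x
    rw [hs] at this
    simpa using this
  have := Finset.card_le_card hu
  rw [Finset.card_univ] at this
  have := Finset.card_le_four (a := x) (b := y) (c := h) (d := k)
  omega

theorem IsSubcubic.supp_of_diamond (hsub : IsSubcubic G) {x y h k : V} (hhk : G.Adj h k)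
    (hhx : G.Adj h x) (hhy : G.Adj h y) (hkx : G.Adj k x) (hky : G.Adj k y) (hne : x ≠ y)
    (hxy : ¬ G.Adj x y) :
    ((triangleGraph G).connectedComponentMk h).supp = {x, y, h, k} := by
  refine supp_connectedComponentMk_eq (by simp) ?_ ?_
  · intro w hw
    simp only [Set.mem_insert_iff, Set.mem_singleton_iff] at hw
    rcases hw with rfl | rfl | rfl | rfl
    · exact (triangleGraph_adj_of_triangle hhx hkx.symm hhk).reachable
    · exact (triangleGraph_adj_of_triangle hhy hky.symm hhk).reachable
    · rfl
    · exact (triangleGraph_adj_of_triangle hhk hkx hhx).reachable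
  · rintro w hw z ⟨hwz, u, hwu, hzu⟩
    have hh : ∀ {z}, G.Adj h z → _ := fun hz =>
      hsub.eq_or_eq_or_eq hhx hhy hhk hne hkx.ne.symm hky.ne.symm hz
    have hk : ∀ {z}, G.Adj k z → _ := fun hz =>
      hsub.eq_or_eq_or_eq hkx hky hhk.symm hne hhx.ne.symm hhy.ne.symm hz
    -- A third neighbor `z` of the end `x` shares no triangle with it: the third corner would be `h`
    -- or `k`, whose neighborhoods are already full.
    have hends : ∀ {x y : V}, G.Adj h x → G.Adj k x → ¬ G.Adj x y →
        (∀ {z}, G.Adj h z → z = x ∨ z = y ∨ z = k) → (∀ {z}, G.Adj k z → z = x ∨ z = y ∨ z = h) →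
        G.Adj x z → G.Adj x u → z = h ∨ z = k := by
      intro x y hhx hkx hxy hh hk hxz hxu
      by_contra! hz
      rcases hsub.eq_or_eq_or_eq hhx.symm hkx.symm hxz hhk.ne hz.1.symm hz.2.symm hxu
        with rfl | rfl | rfl
      · rcases hh hzu.symm with rfl | rfl | rfl
        · exact hxz.ne rfl
        · exact hxy hxz
        · exact hz.2 rfl
      · rcases hk hzu.symm with rfl | rfl | rfl
        · exact hxz.ne rfl
        · exact hxy hxz
        · exact hz.1 rfl
      · exact hzu.ne rfl
    simp only [Set.mem_insert_iff, Set.mem_singleton_iff] at hw ⊢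
    rcases hw with rfl | rfl | rfl | rfl
    · have := hends hhx hkx hxy hh hk hwz hwu
      tauto
    · have := hends hhy hky (fun h => hxy h.symm) (fun hz => by have := hh hz; tauto)
        (fun hz => by have := hk hz; tauto) hwz hwu
      tauto
    · have := hh hwz
      tauto
    · have := hk hwz
      tauto

/-- The last three hypotheses say that no edge of the triangle lies in a second triangle. A triangle
edge leaving at a corner would, by the degree bound, have another corner as its apex and so contain
such a second triangle. -/
theorem IsSubcubic.supp_of_triangle (hsub : IsSubcubic G) {a b c : V} (hab : G.Adj a b)
    (hbc : G.Adj b c) (hac : G.Adj a c) (h1 : ∀ d, G.Adj d a → G.Adj d b → d = c)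
    (h2 : ∀ d, G.Adj d b → G.Adj d c → d = a) (h3 : ∀ d, G.Adj d a → G.Adj d c → d = b) :
    ((triangleGraph G).connectedComponentMk a).supp = {a, b, c} := by
  have key : ∀ {a b c z : V}, G.Adj a b → G.Adj b c → G.Adj a c →
      (∀ d, G.Adj d a → G.Adj d b → d = c) → (∀ d, G.Adj d a → G.Adj d c → d = b) →
      (triangleGraph G).Adj a z → z = b ∨ z = c := by
    rintro a b c z hab hbc hac h1 h3 ⟨haz, w, haw, hzw⟩
    by_contra! hz
    rcases hsub.eq_or_eq_or_eq hab hac haz hbc.ne hz.1.symm hz.2.symm haw with rfl | rfl | rfl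
    · exact hz.2 (h1 z haz.symm hzw)
    · exact hz.1 (h3 z haz.symm hzw)
    · exact hzw.ne rfl
  refine supp_connectedComponentMk_eq (by simp) ?_ ?_
  · intro w hw
    simp only [Set.mem_insert_iff, Set.mem_singleton_iff] at hw
    rcases hw with rfl | rfl | rfl
    · rfl
    · exact (triangleGraph_adj_of_triangle hab hbc hac).reachable
    · exact (triangleGraph_adj_of_triangle hac hbc.symm hab).reachable
  · intro w hw z hz
    simp only [Set.mem_insert_iff, Set.mem_singleton_iff] at hw ⊢
    rcases hw with rfl | rfl | rfl
    · have := key hab hbc hac h1 h3 hz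
      tauto
    · have := key hab.symm hac hbc (fun d p q => h1 d q p) h2 hz
      tauto
    · have := key hac.symm hab hbc.symm (fun d p q => h3 d q p) (fun d p q => h2 d q p) hz
      tauto

/-- In a connected subcubic graph of order at least `6`, the edges in triangles form isolated
vertices, triangles, and diamonds. -/
theorem IsSubcubic.supp_cases (hsub : IsSubcubic G) (hconn : G.Connected)
    (hcard : 6 ≤ Fintype.card V) (K : (triangleGraph G).ConnectedComponent) :
    (∃ v, (∀ w, ¬ (triangleGraph G).Adj v w) ∧ K.supp = {v}) ∨
    (∃ a b c, G.Adj a b ∧ G.Adj b c ∧ G.Adj a c ∧ K.supp = {a, b, c}) ∨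
    (∃ x y h k, G.Adj h k ∧ G.Adj h x ∧ G.Adj h y ∧ G.Adj k x ∧ G.Adj k y ∧ x ≠ y ∧
      ¬ G.Adj x y ∧ K.supp = {x, y, h, k}) := by
  induction K using ConnectedComponent.ind with | _ a
  by_cases hex : ∃ b, (triangleGraph G).Adj a b
  swap
  · refine Or.inl ⟨a, fun w hw => hex ⟨w, hw⟩, ?_⟩
    refine supp_connectedComponentMk_eq (by simp) (by simp) ?_
    rintro w rfl z hz
    exact (hex ⟨z, hz⟩).elim
  obtain ⟨b, hab, c, hac, hbc⟩ := hex
  have hTab := (triangleGraph_adj_of_triangle hab hbc hac)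
  -- If one of the three edges lies in a second triangle, the component is a diamond with that edge
  -- as its central edge.
  by_cases h1 : ∃ d, G.Adj d a ∧ G.Adj d b ∧ d ≠ c
  · obtain ⟨d, hda, hdb, hdc⟩ := h1
    have hn := hsub.not_adj_of_diamond hconn hcard hab hda.symm hac hdb.symm hbc hdc
    exact Or.inr (Or.inr ⟨d, c, a, b, hab, hda.symm, hac, hdb.symm, hbc, hdc, hn,
      hsub.supp_of_diamond hab hda.symm hac hdb.symm hbc hdc hn⟩)
  by_cases h2 : ∃ d, G.Adj d b ∧ G.Adj d c ∧ d ≠ a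
  · obtain ⟨d, hdb, hdc, hda⟩ := h2
    have hn := hsub.not_adj_of_diamond hconn hcard hbc hdb.symm hab.symm hdc.symm hac.symm hda
    refine Or.inr (Or.inr ⟨d, a, b, c, hbc, hdb.symm, hab.symm, hdc.symm, hac.symm, hda, hn, ?_⟩)
    rw [ConnectedComponent.connectedComponentMk_eq_of_adj hTab]
    exact hsub.supp_of_diamond hbc hdb.symm hab.symm hdc.symm hac.symm hda hn
  by_cases h3 : ∃ d, G.Adj d a ∧ G.Adj d c ∧ d ≠ b
  · obtain ⟨d, hda, hdc, hdb⟩ := h3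
    have hn := hsub.not_adj_of_diamond hconn hcard hac hda.symm hab hdc.symm hbc.symm hdb
    exact Or.inr (Or.inr ⟨d, b, a, c, hac, hda.symm, hab, hdc.symm, hbc.symm, hdb, hn,
      hsub.supp_of_diamond hac hda.symm hab hdc.symm hbc.symm hdb hn⟩)
  push Not at h1 h2 h3
  exact Or.inr (Or.inl ⟨a, b, c, hab, hbc, hac, hsub.supp_of_triangle hab hbc hac h1 h2 h3⟩)

end TriangleGraph

/-! ### Local clustering coefficients and vertex weights -/

section LocalCoefficients

variable {V : Type*} {G : SimpleGraph V}

theorem ncard_edgeSet_induce (G : SimpleGraph V) (S : Set V) :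
    (G.induce S).edgeSet.ncard = {e | e ∈ G.edgeSet ∧ ∀ w ∈ e, w ∈ S}.ncard := by
  rw [← Set.ncard_image_of_injective _ (Sym2.map.injective (Subtype.val_injective (p := S)))]
  congr 1
  ext e
  induction e with | h u v
  constructor
  · rintro ⟨e', he', h⟩
    induction e' with | h a b
    simp only [Sym2.map_mk] at h
    rw [← h]
    refine ⟨he', ?_⟩
    intro w hw
    rcases Sym2.mem_iff.1 hw with rfl | rfl
    exacts [a.2, b.2]
  · rintro ⟨he, h⟩
    exact ⟨s(⟨u, h u (by simp)⟩, ⟨v, h v (by simp)⟩), he, by simp⟩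

variable [Fintype V] [DecidableRel G.Adj]

theorem vertexCoeff_eq_zero {v : V} (hv : ∀ w, ¬ (triangleGraph G).Adj v w) :
    vertexCoeff G v = 0 := by
  rw [vertexCoeff]
  split_ifs with h
  · rw [ncard_edgeSet_induce]
    have : {e | e ∈ G.edgeSet ∧ ∀ w ∈ e, w ∈ G.neighborSet v} = ∅ := by
      ext e
      induction e with | h a b
      simp only [Set.mem_ofPred_eq, Set.mem_empty_iff_false, iff_false, not_and]
      intro hab h
      exact hv a ⟨h a (by simp), b, h b (by simp), hab⟩
    rw [this]
    simp
  · rfl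

theorem degree_eq_of_forall {v : V} (s : Finset V) (hs : ∀ w, G.Adj v w ↔ w ∈ s) :
    G.degree v = s.card := by
  rw [← card_neighborFinset_eq_degree]
  congr 1
  ext w
  rw [mem_neighborFinset, hs]

theorem vertexCoeff_of_degree_two {v b c : V} (hv : ∀ w, G.Adj v w ↔ w = b ∨ w = c)
    (hbc : G.Adj b c) : vertexCoeff G v = 1 := by
  classical
  have hd : G.degree v = 2 := by
    rw [degree_eq_of_forall {b, c} (by simpa using hv), Finset.card_pair hbc.ne]
  rw [vertexCoeff, if_pos hd.ge, hd, ncard_edgeSet_induce]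
  have : {e | e ∈ G.edgeSet ∧ ∀ w ∈ e, w ∈ G.neighborSet v} = {s(b, c)} := by
    ext e
    induction e with | h x y
    simp only [Set.mem_ofPred_eq, Set.mem_singleton_iff, mem_edgeSet, Sym2.mem_iff,
      forall_eq_or_imp, forall_eq, mem_neighborSet, hv, Sym2.eq_iff]
    constructor
    · rintro ⟨h, rfl | rfl, rfl | rfl⟩ <;> first | exact (h.ne rfl).elim | tauto
    · rintro (⟨rfl, rfl⟩ | ⟨rfl, rfl⟩)
      · tauto
      · exact ⟨hbc.symm, by tauto⟩
  rw [this, Set.ncard_singleton]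
  norm_num

theorem vertexCoeff_of_degree_three_of_one {v b c z : V}
    (hv : ∀ w, G.Adj v w ↔ w = b ∨ w = c ∨ w = z) (hbc : G.Adj b c) (hbz : ¬ G.Adj b z)
    (hcz : ¬ G.Adj c z) (hzb : z ≠ b) (hzc : z ≠ c) : vertexCoeff G v = 1 / 3 := by
  classical
  have hd : G.degree v = 3 := by
    rw [degree_eq_of_forall {b, c, z} (by simpa using hv), Finset.card_eq_three]
    exact ⟨b, c, z, hbc.ne, hzb.symm, hzc.symm, rfl⟩
  rw [vertexCoeff, if_pos (by omega), hd, ncard_edgeSet_induce]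
  have : {e | e ∈ G.edgeSet ∧ ∀ w ∈ e, w ∈ G.neighborSet v} = {s(b, c)} := by
    ext e
    induction e with | h x y
    simp only [Set.mem_ofPred_eq, Set.mem_singleton_iff, mem_edgeSet, Sym2.mem_iff,
      forall_eq_or_imp, forall_eq, mem_neighborSet, hv, Sym2.eq_iff]
    have hbz' : ¬ G.Adj z b := fun h => hbz h.symm
    have hcz' : ¬ G.Adj z c := fun h => hcz h.symm
    constructor
    · rintro ⟨h, rfl | rfl | rfl, rfl | rfl | rfl⟩ <;> first | exact (h.ne rfl).elim | tauto
    · rintro (⟨rfl, rfl⟩ | ⟨rfl, rfl⟩)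
      · tauto
      · exact ⟨hbc.symm, by tauto⟩
  rw [this, Set.ncard_singleton]
  norm_num [Nat.choose]

theorem vertexCoeff_of_degree_three_of_two {v x y k : V}
    (hv : ∀ w, G.Adj v w ↔ w = x ∨ w = y ∨ w = k) (hxk : G.Adj x k) (hyk : G.Adj y k)
    (hxy : ¬ G.Adj x y) (hne : x ≠ y) : vertexCoeff G v = 2 / 3 := by
  classical
  have hd : G.degree v = 3 := by
    rw [degree_eq_of_forall {x, y, k} (by simpa using hv), Finset.card_eq_three]
    exact ⟨x, y, k, hne, hxk.ne, hyk.ne, rfl⟩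
  rw [vertexCoeff, if_pos (by omega), hd, ncard_edgeSet_induce]
  have : {e | e ∈ G.edgeSet ∧ ∀ w ∈ e, w ∈ G.neighborSet v} = {s(x, k), s(y, k)} := by
    ext e
    induction e with | h a b
    simp only [Set.mem_ofPred_eq, Set.mem_singleton_iff, mem_edgeSet, Sym2.mem_iff,
      Set.mem_insert_iff, forall_eq_or_imp, forall_eq, mem_neighborSet, hv, Sym2.eq_iff]
    have hyx : ¬ G.Adj y x := fun h => hxy h.symm
    constructor
    · rintro ⟨h, rfl | rfl | rfl, rfl | rfl | rfl⟩ <;> first | exact (h.ne rfl).elim | tauto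
    · rintro ((⟨rfl, rfl⟩ | ⟨rfl, rfl⟩) | (⟨rfl, rfl⟩ | ⟨rfl, rfl⟩))
      · tauto
      · exact ⟨hxk.symm, by tauto⟩
      · tauto
      · exact ⟨hyk.symm, by tauto⟩
  rw [this, Set.ncard_pair (by simp [hne, hxk.ne])]
  norm_num [Nat.choose]

open Classical in
/-- The contribution of a vertex to `12 ∑ C_u - 7 n + 14 m`, where `m` is the number of edges that
lie in no triangle. -/
noncomputable def vertexWeight (G : SimpleGraph V) [DecidableRel G.Adj] (v : V) : ℚ :=
  12 * vertexCoeff G v - 7 + 7 * ((G \ triangleGraph G).degree v : ℚ)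

theorem vertexWeight_of_no_triangle {v : V} (hv : ∀ w, ¬ (triangleGraph G).Adj v w) :
    vertexWeight G v = 7 * G.degree v - 7 := by
  classical
  rw [vertexWeight, vertexCoeff_eq_zero hv,
    degree_eq_of_forall (G := G \ triangleGraph G) (G.neighborFinset v) (by simp [hv]),
    card_neighborFinset_eq_degree]
  ring

/-- Degree 2 gives coefficient 1 and no outside edge, hence 12 - 7 = 5. Degree 3 gives coefficient
1/3 and one outside edge, hence 4 - 7 + 7 = 4. The formula covers both. -/
theorem IsSubcubic.vertexWeight_of_two (hsub : IsSubcubic G) {v b c : V} (hbc : G.Adj b c)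
    (hv : ∀ w, (triangleGraph G).Adj v w ↔ w = b ∨ w = c) :
    (G.degree v = 2 ∨ G.degree v = 3) ∧ vertexWeight G v = 7 - G.degree v := by
  classical
  have hb : G.Adj v b := ((hv b).2 (Or.inl rfl)).1
  have hc : G.Adj v c := ((hv c).2 (Or.inr rfl)).1
  have hd : 2 ≤ G.degree v := by
    rw [← card_neighborFinset_eq_degree, ← Finset.card_pair hbc.ne]
    refine Finset.card_le_card fun w hw => ?_
    rw [mem_neighborFinset]
    rcases Finset.mem_insert.1 hw with rfl | hw
    · exact hb
    · rwa [Finset.mem_singleton.1 hw]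
  have hd3 := hsub v
  refine ⟨by omega, ?_⟩
  by_cases h : ∃ z, G.Adj v z ∧ z ≠ b ∧ z ≠ c
  · obtain ⟨z, hz, hzb, hzc⟩ := h
    have hn : ∀ w, G.Adj v w ↔ w = b ∨ w = c ∨ w = z := by
      refine fun w => ⟨hsub.eq_or_eq_or_eq hb hc hz hbc.ne hzb.symm hzc.symm, ?_⟩
      rintro (rfl | rfl | rfl) <;> assumption
    have hT : ∀ d, G.Adj v d → ¬ G.Adj d z := fun d hd hdz => by
      rcases (hv z).1 ⟨hz, d, hd, hdz.symm⟩ with h | h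
      exacts [hzb h, hzc h]
    have h3 : G.degree v = 3 := by
      rw [degree_eq_of_forall {b, c, z} (by simpa using hn), Finset.card_eq_three]
      exact ⟨b, c, z, hbc.ne, hzb.symm, hzc.symm, rfl⟩
    rw [vertexWeight, vertexCoeff_of_degree_three_of_one hn hbc (hT b hb) (hT c hc) hzb hzc,
      degree_eq_of_forall (G := G \ triangleGraph G) {z} ?_, h3, Finset.card_singleton]
    · norm_num
    · intro w
      rw [sdiff_adj, hn, hv, Finset.mem_singleton]
      constructor
      · tauto
      · rintro rfl
        tauto
  · push Not at h
    have hn : ∀ w, G.Adj v w ↔ w = b ∨ w = c := by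
      refine fun w => ⟨fun hw => ?_, ?_⟩
      · by_contra! hh
        exact hh.2 (h w hw hh.1)
      · rintro (rfl | rfl) <;> assumption
    have h2 : G.degree v = 2 := by
      rw [degree_eq_of_forall {b, c} (by simpa using hn), Finset.card_pair hbc.ne]
    rw [vertexWeight, vertexCoeff_of_degree_two hn hbc,
      degree_eq_of_forall (G := G \ triangleGraph G) ∅ ?_, h2, Finset.card_empty]
    · norm_num
    · intro w
      rw [sdiff_adj, hn, hv]
      simp only [Finset.notMem_empty, iff_false]
      tauto

theorem IsSubcubic.degree_of_hub (hsub : IsSubcubic G) {x y h k : V} (hhk : G.Adj h k)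
    (hhx : G.Adj h x) (hhy : G.Adj h y) (hkx : G.Adj k x) (hky : G.Adj k y) (hne : x ≠ y) :
    G.degree h = 3 := by
  classical
  refine le_antisymm (hsub h) ?_
  rw [← card_neighborFinset_eq_degree,
    ← Finset.card_eq_three.2 ⟨x, y, k, hne, hkx.ne.symm, hky.ne.symm, rfl⟩]
  refine Finset.card_le_card fun w hw => ?_
  simp only [Finset.mem_insert, Finset.mem_singleton] at hw
  rw [mem_neighborFinset]
  rcases hw with rfl | rfl | rfl <;> assumption

/-- All three edges at `h` lie in triangles, so only 12 · (2/3) - 7 remains. -/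
theorem IsSubcubic.vertexWeight_of_hub (hsub : IsSubcubic G) {x y h k : V} (hhk : G.Adj h k)
    (hhx : G.Adj h x) (hhy : G.Adj h y) (hkx : G.Adj k x) (hky : G.Adj k y) (hne : x ≠ y)
    (hxy : ¬ G.Adj x y) : vertexWeight G h = 1 := by
  classical
  have hn : ∀ w, G.Adj h w ↔ w = x ∨ w = y ∨ w = k := by
    refine fun w => ⟨hsub.eq_or_eq_or_eq hhx hhy hhk hne hkx.ne.symm hky.ne.symm, ?_⟩
    rintro (rfl | rfl | rfl) <;> assumption
  rw [vertexWeight, vertexCoeff_of_degree_three_of_two hn hkx.symm hky.symm hxy hne,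
    degree_eq_of_forall (G := G \ triangleGraph G) ∅ ?_, Finset.card_empty]
  · norm_num
  · intro w
    rw [sdiff_adj, hn]
    simp only [Finset.notMem_empty, iff_false, not_and, not_not]
    rintro (rfl | rfl | rfl)
    · exact ⟨hhx, k, hhk, hkx.symm⟩
    · exact ⟨hhy, k, hhk, hky.symm⟩
    · exact ⟨hhk, x, hhx, hkx⟩

end LocalCoefficients

/-! ### Weights of the components of the triangle graph -/

section ComponentWeights

theorem exists_adj_leaving {V : Type*} [Fintype V] {G : SimpleGraph V}
    (hconn : G.Connected) {S : Set V} (hS : S.Nonempty)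
    (hne : S.ncard < Fintype.card V) : ∃ v ∈ S, ∃ w, w ∉ S ∧ G.Adj v w := by
  obtain ⟨a, ha⟩ := hS
  by_contra! h
  have : S = Set.univ := by
    have h1 : (G.connectedComponentMk a).supp = S :=
      supp_connectedComponentMk_eq ha (fun w _ => hconn.preconnected a w) fun w hw z hz => by
        by_contra hzS
        exact h w hw z hzS hz
    rw [← h1]
    ext w
    simpa [ConnectedComponent.mem_supp_iff] using hconn.preconnected w a
  rw [this, Set.ncard_univ, Nat.card_eq_fintype_card] at hne
  exact hne.ne rfl

theorem mem_supp_of_triangleGraph_adj {V : Type*} {G : SimpleGraph V}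
    {K : (triangleGraph G).ConnectedComponent} {v w : V}
    (hv : v ∈ K.supp) (h : (triangleGraph G).Adj v w) : w ∈ K.supp :=
  (ConnectedComponent.mem_supp_congr_adj K h).1 hv

variable {V : Type*} [Fintype V] {G : SimpleGraph V} [DecidableRel G.Adj]

open Classical in
/-- The contribution of a component of the triangle graph to the excess of the clustering
coefficient, normalized so that single cubic vertices and pendant triangles contribute `0`. -/
noncomputable def componentWeight (G : SimpleGraph V) [DecidableRel G.Adj]
    (K : (triangleGraph G).ConnectedComponent) : ℚ :=
  ∑ v with (triangleGraph G).connectedComponentMk v = K, vertexWeight G v - 14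

/-- The number of vertices of degree `3` in a set. -/
noncomputable def numCubic (G : SimpleGraph V) [DecidableRel G.Adj] (S : Set V) : ℕ :=
  {v : V | v ∈ S ∧ G.degree v = 3}.ncard

theorem componentWeight_eq {K : (triangleGraph G).ConnectedComponent} {F : Finset V}
    (h : K.supp = F) : componentWeight G K = ∑ v ∈ F, vertexWeight G v - 14 := by
  classical
  rw [componentWeight]
  congr 2
  ext v
  have : v ∈ K.supp ↔ v ∈ (F : Set V) := by rw [h]
  simpa [ConnectedComponent.mem_supp_iff] using this

theorem numCubic_coe (F : Finset V) : numCubic G F = ∑ v ∈ F, if G.degree v = 3 then 1 else 0 := by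
  classical
  rw [← Finset.card_filter, numCubic, ← Set.ncard_coe_finset]
  congr 1
  ext v
  simp

theorem IsSubcubic.degree_eq_three (hsub : IsSubcubic G) {v a b c : V} (ha : G.Adj v a)
    (hb : G.Adj v b) (hc : G.Adj v c) (hab : a ≠ b) (hac : a ≠ c) (hbc : b ≠ c) :
    G.degree v = 3 := by
  classical
  rw [degree_eq_of_forall {a, b, c}, Finset.card_eq_three]
  · exact ⟨a, b, c, hab, hac, hbc, rfl⟩
  · intro w
    simp only [Finset.mem_insert, Finset.mem_singleton]
    refine ⟨hsub.eq_or_eq_or_eq ha hb hc hab hac hbc, ?_⟩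
    rintro (rfl | rfl | rfl) <;> assumption

/-- The shape, the number of cubic vertices and the weight of a component of the triangle graph. -/
theorem IsSubcubic.componentWeight_cases (hsub : IsSubcubic G) (hconn : G.Connected)
    (hcard : 6 ≤ Fintype.card V) (K : (triangleGraph G).ConnectedComponent) :
    (∃ v, (∀ w, ¬ (triangleGraph G).Adj v w) ∧ K.supp = {v} ∧
      componentWeight G K = 7 * G.degree v - 21) ∨
    (K.supp.ncard = 3 ∧ 1 ≤ numCubic G K.supp ∧ numCubic G K.supp ≤ 3 ∧
      componentWeight G K = 1 - numCubic G K.supp) ∨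
    (K.supp.ncard = 4 ∧ 3 ≤ numCubic G K.supp ∧ numCubic G K.supp ≤ 4 ∧
      componentWeight G K = - numCubic G K.supp) := by
  classical
  rcases hsub.supp_cases hconn hcard K with ⟨v, hv, hs⟩ | ⟨a, b, c, hab, hbc, hac, hs⟩ |
    ⟨x, y, h, k, hhk, hhx, hhy, hkx, hky, hne, hxy, hs⟩
  · refine Or.inl ⟨v, hv, hs, ?_⟩
    rw [componentWeight_eq (F := {v}) (by simpa using hs), Finset.sum_singleton,
      vertexWeight_of_no_triangle hv]
    ring
  · refine Or.inr (Or.inl ?_)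
    have hF : K.supp = (({a, b, c} : Finset V) : Set V) := by simpa using hs
    have hcl : ∀ {v w}, v ∈ K.supp → (triangleGraph G).Adj v w → w = a ∨ w = b ∨ w = c := by
      intro v w hv h
      have := mem_supp_of_triangleGraph_adj hv h
      rw [hs] at this
      simpa using this
    have hTab := triangleGraph_adj_of_triangle hab hbc hac
    have hTac := triangleGraph_adj_of_triangle hac hbc.symm hab
    have hTbc := triangleGraph_adj_of_triangle hbc hac.symm hab.symm
    obtain ⟨hda, hwa⟩ := hsub.vertexWeight_of_two hbc (v := a) fun w => by
      refine ⟨fun h => ?_, by rintro (rfl | rfl) <;> assumption⟩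
      have := hcl (by simp [hs]) h
      have := h.ne
      tauto
    obtain ⟨hdb, hwb⟩ := hsub.vertexWeight_of_two hac (v := b) fun w => by
      refine ⟨fun h => ?_, by rintro (rfl | rfl) <;> first | exact hTab.symm | assumption⟩
      have := hcl (by simp [hs]) h
      have := h.ne
      tauto
    obtain ⟨hdc, hwc⟩ := hsub.vertexWeight_of_two hab (v := c) fun w => by
      refine ⟨fun h => ?_, by rintro (rfl | rfl) <;> first | exact hTac.symm | exact hTbc.symm⟩
      have := hcl (by simp [hs]) h
      have := h.ne
      tauto
    have hn : K.supp.ncard = 3 := by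
      rw [hF, Set.ncard_coe_finset, Finset.card_eq_three]
      exact ⟨a, b, c, hab.ne, hac.ne, hbc.ne, rfl⟩
    -- An edge leaves the component, and its end inside is cubic. This excludes the one triangle
    -- weight that would be positive.
    have hleave : G.degree a = 3 ∨ G.degree b = 3 ∨ G.degree c = 3 := by
      obtain ⟨v, hv, w, hw, hvw⟩ := exists_adj_leaving hconn K.nonempty_supp (by omega)
      rw [hs] at hv hw
      simp only [Set.mem_insert_iff, Set.mem_singleton_iff, not_or] at hv hw
      obtain ⟨hwa, hwb, hwc⟩ := hw
      rcases hv with rfl | rfl | rfl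
      · exact Or.inl (hsub.degree_eq_three hab hac hvw hbc.ne (Ne.symm hwb) (Ne.symm hwc))
      · exact Or.inr (Or.inl
          (hsub.degree_eq_three hab.symm hbc hvw hac.ne (Ne.symm hwa) (Ne.symm hwc)))
      · exact Or.inr (Or.inr
          (hsub.degree_eq_three hac.symm hbc.symm hvw hab.ne (Ne.symm hwa) (Ne.symm hwb)))
    have hna : a ∉ ({b, c} : Finset V) := by simp [hab.ne, hac.ne]
    have hnb : b ∉ ({c} : Finset V) := by simp [hbc.ne]
    refine ⟨hn, ?_⟩
    rw [componentWeight_eq hF, hF, numCubic_coe, Finset.sum_insert hna, Finset.sum_insert hnb,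
      Finset.sum_singleton, Finset.sum_insert hna, Finset.sum_insert hnb, Finset.sum_singleton,
      hwa, hwb, hwc]
    rcases hda with hda | hda <;> rcases hdb with hdb | hdb <;> rcases hdc with hdc | hdc <;>
      simp [hda, hdb, hdc] at hleave <;> norm_num [hda, hdb, hdc]
  · refine Or.inr (Or.inr ?_)
    have hF : K.supp = (({x, y, h, k} : Finset V) : Set V) := by simpa using hs
    have hcl : ∀ {v w}, v ∈ K.supp → (triangleGraph G).Adj v w →
        w = x ∨ w = y ∨ w = h ∨ w = k := by
      intro v w hv h
      have := mem_supp_of_triangleGraph_adj hv h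
      rw [hs] at this
      simpa using this
    have hThx := triangleGraph_adj_of_triangle hhx hkx.symm hhk
    have hThy := triangleGraph_adj_of_triangle hhy hky.symm hhk
    have hTkx := triangleGraph_adj_of_triangle hkx hhx.symm hhk.symm
    have hTky := triangleGraph_adj_of_triangle hky hhy.symm hhk.symm
    obtain ⟨hdx, hwx⟩ := hsub.vertexWeight_of_two hhk (v := x) fun w => by
      refine ⟨fun h => ?_, by rintro (rfl | rfl) <;> first | exact hThx.symm | exact hTkx.symm⟩
      have := hcl (by simp [hs]) h
      have h1 := h.ne
      have h2 : w ≠ y := by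
        rintro rfl
        exact hxy h.1
      tauto
    obtain ⟨hdy, hwy⟩ := hsub.vertexWeight_of_two hhk (v := y) fun w => by
      refine ⟨fun h => ?_, by rintro (rfl | rfl) <;> first | exact hThy.symm | exact hTky.symm⟩
      have := hcl (by simp [hs]) h
      have h1 := h.ne
      have h2 : w ≠ x := by
        rintro rfl
        exact hxy h.1.symm
      tauto
    have hdh := hsub.degree_of_hub hhk hhx hhy hkx hky hne
    have hdk := hsub.degree_of_hub hhk.symm hkx hky hhx hhy hne
    have hwh := hsub.vertexWeight_of_hub hhk hhx hhy hkx hky hne hxy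
    have hwk := hsub.vertexWeight_of_hub hhk.symm hkx hky hhx hhy hne hxy
    have hnx : x ∉ ({y, h, k} : Finset V) := by simp [hne, hhx.ne.symm, hkx.ne.symm]
    have hny : y ∉ ({h, k} : Finset V) := by simp [hhy.ne.symm, hky.ne.symm]
    have hnh : h ∉ ({k} : Finset V) := by simp [hhk.ne]
    have hn : K.supp.ncard = 4 := by
      rw [hF, Set.ncard_coe_finset, Finset.card_insert_of_notMem hnx,
        Finset.card_insert_of_notMem hny, Finset.card_pair hhk.ne]
    -- The leaving edge cannot start at `h` or `k`, whose three neighbors all lie in the diamond.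
    have hleave : G.degree x = 3 ∨ G.degree y = 3 := by
      obtain ⟨v, hv, w, hw, hvw⟩ := exists_adj_leaving hconn K.nonempty_supp (by omega)
      rw [hs] at hv hw
      simp only [Set.mem_insert_iff, Set.mem_singleton_iff, not_or] at hv hw
      obtain ⟨hwx, hwy, hwh, hwk⟩ := hw
      rcases hv with rfl | rfl | rfl | rfl
      · exact Or.inl
          (hsub.degree_eq_three hhx.symm hkx.symm hvw hhk.ne (Ne.symm hwh) (Ne.symm hwk))
      · exact Or.inr
          (hsub.degree_eq_three hhy.symm hky.symm hvw hhk.ne (Ne.symm hwh) (Ne.symm hwk))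
      · have := hsub.eq_or_eq_or_eq hhx hhy hhk hne hkx.ne.symm hky.ne.symm hvw
        tauto
      · have := hsub.eq_or_eq_or_eq hkx hky hhk.symm hne hhx.ne.symm hhy.ne.symm hvw
        tauto
    refine ⟨hn, ?_⟩
    rw [componentWeight_eq hF, hF, numCubic_coe, Finset.sum_insert hnx, Finset.sum_insert hny,
      Finset.sum_insert hnh, Finset.sum_singleton, Finset.sum_insert hnx, Finset.sum_insert hny,
      Finset.sum_insert hnh, Finset.sum_singleton, hwx, hwy, hwh, hwk]
    rcases hdx with hdx | hdx <;> rcases hdy with hdy | hdy <;>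
      simp [hdx, hdy] at hleave <;> norm_num [hdx, hdy, hdh, hdk]

/-- `12 ∑ C_u - 7 n` in terms of the number of components of the triangle graph, the number of
edges outside the triangle graph, and the component weights. -/
theorem sum_vertexCoeff_eq (G : SimpleGraph V) [DecidableRel G.Adj]
    [Fintype (triangleGraph G).ConnectedComponent] :
    12 * ∑ v, vertexCoeff G v - 7 * (Fintype.card V : ℚ) =
      14 * (Nat.card (triangleGraph G).ConnectedComponent : ℚ)
        - 14 * ((G \ triangleGraph G).edgeSet.ncard : ℚ)
        + ∑ K : (triangleGraph G).ConnectedComponent, componentWeight G K := by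
  classical
  have h1 : ∑ K : (triangleGraph G).ConnectedComponent, (componentWeight G K + 14)
      = ∑ v, vertexWeight G v := by
    rw [← Finset.sum_fiberwise Finset.univ (triangleGraph G).connectedComponentMk]
    refine Finset.sum_congr rfl fun K _ => ?_
    rw [componentWeight]
    ring_nf
  -- Handshake lemma: the coefficient 7 per outside degree becomes 14 per outside edge.
  have h2 : (∑ v, ((G \ triangleGraph G).degree v : ℚ)) =
      2 * ((G \ triangleGraph G).edgeSet.ncard : ℚ) := by
    have h := sum_degrees_eq_twice_card_edges (G \ triangleGraph G)
    rw [← Set.ncard_coe_finset, coe_edgeFinset] at h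
    exact_mod_cast h
  have h3 : ∑ v, vertexWeight G v = 12 * ∑ v, vertexCoeff G v - 7 * (Fintype.card V : ℚ)
      + 7 * ∑ v, ((G \ triangleGraph G).degree v : ℚ) := by
    rw [Finset.mul_sum, Finset.mul_sum]
    simp only [vertexWeight, Finset.sum_add_distrib, Finset.sum_sub_distrib, Finset.sum_const,
      Finset.card_univ, nsmul_eq_mul]
    ring_nf
  rw [Finset.sum_add_distrib, h3, h2, Finset.sum_const, Finset.card_univ, nsmul_eq_mul] at h1
  rw [Nat.card_eq_fintype_card]
  linarith

end ComponentWeights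

/-! ### Nonseparable subgraphs, bridges and cut vertices -/

section Nonseparable

variable {V : Type*} {G : SimpleGraph V}

theorem connected_of_universal {H : G.Subgraph} {c : V} (hc : c ∈ H.verts)
    (h : ∀ w ∈ H.verts, w = c ∨ H.Adj c w) : H.Connected := by
  refine ⟨(connected_iff_exists_forall_reachable _).2 ⟨⟨c, hc⟩, fun ⟨w, hw⟩ => ?_⟩⟩
  rcases h w hw with rfl | h
  · rfl
  · exact Adj.reachable (G := H.coe) h

/-- A vertex adjacent to all others makes a graph connected, so it suffices that such a vertex
exists in `S` and after the removal of any one vertex. `K_2`, triangles and diamonds all qualify. -/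
theorem isNonseparable_induce {S : Set V} (h0 : ∃ c ∈ S, ∀ w ∈ S, w = c ∨ G.Adj c w)
    (h : ∀ v ∈ S, ∃ c ∈ S, c ≠ v ∧ ∀ w ∈ S, w ≠ v → w = c ∨ G.Adj c w) :
    IsNonseparable ((⊤ : G.Subgraph).induce S) := by
  constructor
  · obtain ⟨c, hc, h⟩ := h0
    refine connected_of_universal (c := c) hc fun w hw => ?_
    rcases h w hw with h | h
    · exact Or.inl h
    · exact Or.inr ⟨hc, hw, h⟩
  · intro v hv
    obtain ⟨c, hc, hcv, h⟩ := h v hv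
    refine (connected_of_universal (H := ((⊤ : G.Subgraph).induce S).deleteVerts {v}) (c := c)
      ⟨hc, hcv⟩ ?_).preconnected
    rintro w ⟨hw, hwv⟩
    rcases h w hw hwv with h | h
    · exact Or.inl h
    · exact Or.inr ⟨⟨hc, hcv⟩, ⟨hw, hwv⟩, hc, hw, h⟩

theorem isNonseparable_induce_pair {u v : V} (h : G.Adj u v) :
    IsNonseparable ((⊤ : G.Subgraph).induce {u, v}) := by
  refine isNonseparable_induce ⟨u, by simp, ?_⟩ ?_
  · rintro w (rfl | rfl)
    · exact Or.inl rfl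
    · exact Or.inr h
  · rintro w (rfl | rfl)
    · refine ⟨v, by simp, h.ne.symm, ?_⟩
      rintro w (rfl | rfl) hw
      · exact (hw rfl).elim
      · exact Or.inl rfl
    · refine ⟨u, by simp, h.ne, ?_⟩
      rintro w (rfl | rfl) hw
      · exact Or.inl rfl
      · exact (hw rfl).elim

theorem isNonseparable_induce_triangle {a b c : V} (hab : G.Adj a b) (hbc : G.Adj b c)
    (hac : G.Adj a c) : IsNonseparable ((⊤ : G.Subgraph).induce {a, b, c}) := by
  have hab' := hab.symm
  have hbc' := hbc.symm
  have hac' := hac.symm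
  have hne := hab.ne.symm
  have hne' := hac.ne
  have hne2 := hbc.ne
  refine isNonseparable_induce ⟨a, by simp, ?_⟩ ?_
  · rintro w (rfl | rfl | rfl) <;> tauto
  · rintro w (rfl | rfl | rfl)
    · refine ⟨b, by simp, hne, ?_⟩
      rintro w (rfl | rfl | rfl) hw <;> tauto
    · refine ⟨a, by simp, hne.symm, ?_⟩
      rintro w (rfl | rfl | rfl) hw <;> tauto
    · refine ⟨a, by simp, hne', ?_⟩
      rintro w (rfl | rfl | rfl) hw <;> tauto

theorem isNonseparable_induce_diamond {x y h k : V} (hhk : G.Adj h k) (hhx : G.Adj h x)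
    (hhy : G.Adj h y) (hkx : G.Adj k x) (hky : G.Adj k y) :
    IsNonseparable ((⊤ : G.Subgraph).induce {x, y, h, k}) := by
  have hh : ∀ w ∈ ({x, y, h, k} : Set V), w = h ∨ G.Adj h w := by
    rintro w (rfl | rfl | rfl | rfl) <;> tauto
  have hk : ∀ w ∈ ({x, y, h, k} : Set V), w = k ∨ G.Adj k w := by
    have := hhk.symm
    rintro w (rfl | rfl | rfl | rfl) <;> tauto
  refine isNonseparable_induce ⟨h, by simp, hh⟩ ?_
  intro v _
  by_cases hv : h = v
  · exact ⟨k, by simp, fun e => hhk.ne (hv.trans e.symm), fun w hw _ => hk w hw⟩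
  · exact ⟨h, by simp, hv, fun w hw _ => hh w hw⟩

/-- A non-bridge lies in a nonseparable subgraph with at least three vertices. -/
theorem exists_isNonseparable_of_not_isBridge {u v : V} (huv : G.Adj u v)
    (h : ¬ G.IsBridge s(u, v)) : ∃ H : G.Subgraph, IsNonseparable H ∧ H.Adj u v ∧
      ∃ w ∈ H.verts, w ≠ u ∧ w ≠ v := by
  classical
  rw [isBridge_iff, not_not] at h
  obtain ⟨q, hq⟩ := h.exists_isPath
  -- The path `p` closes with the edge `uv` to a cycle; its vertex set induces the required
  -- subgraph.
  obtain ⟨p, hp, huvp⟩ : ∃ p : G.Walk u v, p.IsPath ∧ s(u, v) ∉ p.edges := by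
    refine ⟨q.mapLe (deleteEdges_le _), hq.mapLe _, fun hm => ?_⟩
    rw [Walk.edges_mapLe_eq_edges] at hm
    simpa using q.edges_subset_edgeSet hm
  set S : Set V := {w | w ∈ p.support} with hS
  refine ⟨(⊤ : G.Subgraph).induce S, ⟨?_, ?_⟩, ⟨p.start_mem_support, p.end_mem_support, huv⟩, ?_⟩
  · exact p.toSubgraph_connected.mono (by rw [hS]; exact p.toSubgraph_le_induce_support)
      (by simp [hS, Walk.verts_toSubgraph])
  · intro x hx
    have hx : x ∈ p.support := hx
    have mono : ∀ {a b : V} (r : G.Walk a b), (∀ w ∈ r.support, w ∈ S \ {x}) →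
        ∀ (ha : a ∈ S \ {x}) (hb : b ∈ S \ {x}),
        (((⊤ : G.Subgraph).induce S).deleteVerts {x}).coe.Reachable ⟨a, ha⟩ ⟨b, hb⟩ := by
      intro a b r
      induction r with
      | nil => intro _ _ _; rfl
      | @cons a c b hac r ih =>
        intro hr ha hb
        have hc : c ∈ S \ {x} := hr c (by simp)
        refine Reachable.trans (v := ⟨c, hc⟩) (Adj.reachable ?_)
          (ih (fun w hw => hr w (by simp [hw])) hc hb)
        exact ⟨ha, hc, ha.1, hc.1, hac⟩
    -- Removing `x` cuts the path in two. Vertices before `x` are still joined to `u`, those after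
    -- `x` to `v`, and the edge `uv` reconnects the two arcs.
    have hleft : ∀ (w) (hw : w ∈ S \ {x}), w ∈ (p.takeUntil x hx).support →
        ∃ hu : u ∈ S \ {x},
        (((⊤ : G.Subgraph).induce S).deleteVerts {x}).coe.Reachable ⟨w, hw⟩ ⟨u, hu⟩ := by
      intro w hw hwt
      have hpt := hp.takeUntil hx
      have hxn : x ∉ ((p.takeUntil x hx).takeUntil w hwt).support :=
        Walk.endpoint_notMem_support_takeUntil hpt hwt (Ne.symm hw.2)
      have hr : ∀ z ∈ ((p.takeUntil x hx).takeUntil w hwt).support, z ∈ S \ {x} :=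
        fun z hz => ⟨p.support_takeUntil_subset_support hx
          ((p.takeUntil x hx).support_takeUntil_subset_support hwt hz), fun e => hxn (e ▸ hz)⟩
      have hu : u ∈ S \ {x} := hr u (Walk.start_mem_support _)
      exact ⟨hu, (mono _ hr hu hw).symm⟩
    have hright : ∀ (w) (hw : w ∈ S \ {x}), w ∈ (p.dropUntil x hx).support →
        ∃ hv : v ∈ S \ {x},
        (((⊤ : G.Subgraph).induce S).deleteVerts {x}).coe.Reachable ⟨w, hw⟩ ⟨v, hv⟩ := by
      intro w hw hwt
      have hpt := (hp.dropUntil hx).reverse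
      have hwt' : w ∈ (p.dropUntil x hx).reverse.support := by simpa using hwt
      have hxn : x ∉ ((p.dropUntil x hx).reverse.takeUntil w hwt').support :=
        Walk.endpoint_notMem_support_takeUntil hpt hwt' (Ne.symm hw.2)
      have hr : ∀ z ∈ ((p.dropUntil x hx).reverse.takeUntil w hwt').support, z ∈ S \ {x} :=
        fun z hz => ⟨p.support_dropUntil_subset_support hx (by
          simpa using (p.dropUntil x hx).reverse.support_takeUntil_subset_support hwt' hz),
          fun e => hxn (e ▸ hz)⟩
      have hv : v ∈ S \ {x} := hr v (Walk.start_mem_support _)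
      exact ⟨hv, (mono _ hr hv hw).symm⟩
    have hsplit : ∀ w ∈ S, w ∈ (p.takeUntil x hx).support ∨ w ∈ (p.dropUntil x hx).support := by
      intro w hw
      have hw : w ∈ p.support := hw
      rw [← p.take_spec hx, Walk.mem_support_append_iff] at hw
      exact hw
    have hends : ∀ (hu : u ∈ S \ {x}) (hv : v ∈ S \ {x}),
        (((⊤ : G.Subgraph).induce S).deleteVerts {x}).coe.Reachable ⟨u, hu⟩ ⟨v, hv⟩ :=
      fun hu hv => Adj.reachable ⟨hu, hv, hu.1, hv.1, huv⟩
    refine ⟨?_⟩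
    rintro ⟨a, ha⟩ ⟨b, hb⟩
    rcases hsplit a ha.1 with h1 | h1 <;> rcases hsplit b hb.1 with h2 | h2
    · obtain ⟨_, ra⟩ := hleft a ha h1
      obtain ⟨_, rb⟩ := hleft b hb h2
      exact ra.trans rb.symm
    · obtain ⟨hu, ra⟩ := hleft a ha h1
      obtain ⟨hv, rb⟩ := hright b hb h2
      exact (ra.trans (hends hu hv)).trans rb.symm
    · obtain ⟨hv, ra⟩ := hright a ha h1
      obtain ⟨hu, rb⟩ := hleft b hb h2
      exact (ra.trans (hends hu hv).symm).trans rb.symm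
    · obtain ⟨_, ra⟩ := hright a ha h1
      obtain ⟨_, rb⟩ := hright b hb h2
      exact ra.trans rb.symm
  · cases p with
    | nil => exact (huv.ne rfl).elim
    | @cons _ w _ huw p =>
      refine ⟨w, by simp [hS], huw.ne.symm, ?_⟩
      rintro rfl
      exact huvp (by simp)

theorem le_induce_top {H : G.Subgraph} {S : Set V} (h : H.verts ⊆ S) :
    H ≤ (⊤ : G.Subgraph).induce S :=
  ⟨h, fun _ _ hab => ⟨h (H.edge_vert hab), h (H.edge_vert hab.symm), H.adj_sub hab⟩⟩

theorem exists_isBlock_le [Finite V] {H : G.Subgraph} (h : IsNonseparable H) :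
    ∃ B, H ≤ B ∧ IsBlock B :=
  Finite.exists_le_maximal h

/-- A nonseparable subgraph that contains a bridge is just that bridge. -/
theorem IsNonseparable.verts_eq_of_isBridge {B : G.Subgraph} (hB : IsNonseparable B) {u v : V}
    (huv : B.Adj u v) (hb : G.IsBridge s(u, v)) : B.verts = {u, v} := by
  have hu : u ∈ B.verts := B.edge_vert huv
  have hv : v ∈ B.verts := B.edge_vert huv.symm
  -- Deleting an end of the bridge from `B` also destroys the bridge, so the connections that remain
  -- in `B` avoid it. A third vertex `w` would then link `u` to `v` without the bridge.
  have key : ∀ x ∈ B.verts, (x = u ∨ x = v) → ∀ a b, a ∈ B.verts → b ∈ B.verts → a ≠ x → b ≠ x →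
      (G.deleteEdges {s(u, v)}).Reachable a b := by
    intro x hx hxuv a b ha hb hax hbx
    have hr := (hB.2 x hx) ⟨a, ha, hax⟩ ⟨b, hb, hbx⟩
    refine hr.map ⟨Subtype.val, ?_⟩
    rintro ⟨c, hc⟩ ⟨d, hd⟩ hcd
    have h := Subgraph.deleteVerts_adj.1 hcd
    rw [deleteEdges_adj]
    refine ⟨B.adj_sub h.2.2.2.2, ?_⟩
    have hc : c ≠ x := h.2.1
    have hd : d ≠ x := h.2.2.2.1
    simp only [Set.mem_singleton_iff, Sym2.eq_iff]
    rintro (⟨rfl, rfl⟩ | ⟨rfl, rfl⟩) <;> tauto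
  refine Set.Subset.antisymm (fun w hw => ?_) ?_
  · by_contra hwuv
    simp only [Set.mem_insert_iff, Set.mem_singleton_iff, not_or] at hwuv
    refine isBridge_iff.1 hb ?_
    exact (key v hv (Or.inr rfl) u w hu hw huv.ne hwuv.2).trans
      (key u hu (Or.inl rfl) w v hw hv hwuv.1 huv.ne.symm)
  · rintro w (rfl | rfl) <;> assumption

theorem nonempty_iso_top_of_complete {B : G.Subgraph} {n : ℕ} [Finite V]
    (hn : B.verts.ncard = n) (h : ∀ a ∈ B.verts, ∀ b ∈ B.verts, a ≠ b → B.Adj a b) :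
    Nonempty (B.coe ≃g (⊤ : SimpleGraph (Fin n))) := by
  rw [← Nat.card_coe_set_eq] at hn
  refine ⟨⟨Finite.equivFinOfCardEq hn, ?_⟩⟩
  rintro ⟨a, ha⟩ ⟨b, hb⟩
  simp only [top_adj, ne_eq, EmbeddingLike.apply_eq_iff_eq, Subtype.mk.injEq, Subgraph.coe_adj]
  exact ⟨h a ha b hb, fun h => h.ne⟩

theorem ncard_verts_of_iso {B : G.Subgraph} {n : ℕ} {H : SimpleGraph (Fin n)}
    (h : Nonempty (B.coe ≃g H)) : B.verts.ncard = n := by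
  obtain ⟨f⟩ := h
  rw [← Nat.card_coe_set_eq, Nat.card_congr f.toEquiv, Nat.card_fin]

theorem isDiamond_induce {x y h k : V} (hhk : G.Adj h k) (hhx : G.Adj h x)
    (hhy : G.Adj h y) (hkx : G.Adj k x) (hky : G.Adj k y) (hne : x ≠ y) (hxy : ¬ G.Adj x y) :
    IsDiamond ((⊤ : G.Subgraph).induce {x, y, h, k}) := by
  let f : Fin 4 → ((⊤ : G.Subgraph).induce {x, y, h, k}).verts :=
    ![⟨x, by simp⟩, ⟨y, by simp⟩, ⟨h, by simp⟩, ⟨k, by simp⟩]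
  have hf : Function.Bijective f := by
    constructor
    · intro i j hij
      fin_cases i <;> fin_cases j <;>
        simp [f, hne, hne.symm, hhk.ne, hhk.ne.symm, hhx.ne, hhx.ne.symm, hhy.ne, hhy.ne.symm,
          hkx.ne, hkx.ne.symm, hky.ne, hky.ne.symm] at hij ⊢
    · rintro ⟨w, rfl | rfl | rfl | rfl⟩
      exacts [⟨0, rfl⟩, ⟨1, rfl⟩, ⟨2, rfl⟩, ⟨3, rfl⟩]
  refine ⟨RelIso.symm ⟨Equiv.ofBijective f hf, ?_⟩⟩
  intro i j
  fin_cases i <;> fin_cases j <;>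
    simp [f, diamond, hhk, hhk.symm, hhx, hhx.symm, hhy, hhy.symm, hkx, hkx.symm, hky, hky.symm,
      hxy, G.adj_comm y x]

theorem triangleGraph_adj_of_iso {B : G.Subgraph} {W : Type*} {H : SimpleGraph W}
    (f : B.coe ≃g H) (hH : ∀ a b, H.Adj a b → ∃ c, H.Adj a c ∧ H.Adj b c) {u v : V}
    (huv : B.Adj u v) : (triangleGraph G).Adj u v := by
  have h1 : B.coe.Adj ⟨u, B.edge_vert huv⟩ ⟨v, B.edge_vert huv.symm⟩ := huv
  obtain ⟨c, hc1, hc2⟩ := hH _ _ (f.map_adj_iff.2 h1)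
  have h2 := f.symm.map_adj_iff.2 hc1
  have h3 := f.symm.map_adj_iff.2 hc2
  rw [RelIso.symm_apply_apply] at h2 h3
  exact ⟨B.adj_sub huv, _, B.adj_sub h2, B.adj_sub h3⟩

/-- A walk to `v` from any other vertex can be stopped just before its first visit to `v` and
diverted to `c`, so everything other than `v` is joined to `c`. -/
theorem not_isCutVertex (hconn : G.Connected) {v c : V} (hcv : c ≠ v)
    (h : ∀ a, G.Adj v a → a = c ∨ G.Adj a c) : ¬ IsCutVertex G v := by
  rw [IsCutVertex, not_not]
  have key : ∀ w z, G.Walk w z → z = v → ∀ hw : w ≠ v,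
      (G.induce {v}ᶜ).Reachable ⟨w, hw⟩ ⟨c, hcv⟩ := by
    intro w z p hz
    induction p with
    | nil => exact fun hw => (hw hz).elim
    | @cons w a z hwa p ih =>
      intro hw
      by_cases hav : a = v
      · subst hav
        rcases h w hwa.symm with rfl | h
        · rfl
        · exact Adj.reachable (G := G.induce {a}ᶜ) h
      · exact Reachable.trans (Adj.reachable (G := G.induce {v}ᶜ) (v := ⟨a, hav⟩) hwa) (ih hz hav)
  rintro ⟨a, ha⟩ ⟨b, hb⟩
  obtain ⟨p⟩ := hconn.preconnected a v
  obtain ⟨q⟩ := hconn.preconnected b v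
  exact (key a v p rfl ha).trans (key b v q rfl hb).symm

theorem isCutVertex_of_isBridge {x z h : V} (hb : G.IsBridge s(x, z)) (hxz : G.Adj x z)
    (hxh : G.Adj x h) (hhz : h ≠ z) : IsCutVertex G x := by
  intro hpre
  refine isBridge_iff.1 hb ?_
  have h1 : (G.deleteEdges {s(x, z)}).Adj x h := by
    rw [deleteEdges_adj]
    refine ⟨hxh, ?_⟩
    simp only [Set.mem_singleton_iff, Sym2.eq_iff]
    rintro (⟨_, h⟩ | ⟨h, _⟩)
    · exact hhz h
    · exact hxz.ne h
  refine h1.reachable.trans ?_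
  refine (hpre ⟨h, hxh.ne.symm⟩ ⟨z, hxz.ne.symm⟩).map ⟨Subtype.val, ?_⟩
  rintro ⟨a, ha⟩ ⟨b, hb⟩ hab
  rw [deleteEdges_adj]
  refine ⟨hab, ?_⟩
  have ha : a ≠ x := ha
  have hb : b ≠ x := hb
  simp only [Set.mem_singleton_iff, Sym2.eq_iff]
  tauto

end Nonseparable

/-! ### Blocks in terms of bridges and triangle components -/

section Blocks

theorem ncard_diamond {V : Type*} {G : SimpleGraph V} {x y h k : V} (hhk : G.Adj h k) (hhx : G.Adj h x)
    (hhy : G.Adj h y) (hkx : G.Adj k x) (hky : G.Adj k y) (hne : x ≠ y) :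
    ({x, y, h, k} : Set V).ncard = 4 := by
  rw [Set.ncard_insert_of_notMem (by simp [hne, hhx.ne.symm, hkx.ne.symm]),
    Set.ncard_eq_three.2 ⟨y, h, k, hhy.ne.symm, hky.ne.symm, hhk.ne, rfl⟩]

theorem supp_eq_of_induce_eq {V : Type*} {G T : SimpleGraph V} {K K' : T.ConnectedComponent}
    (h : (⊤ : G.Subgraph).induce K.supp = (⊤ : G.Subgraph).induce K'.supp) : K = K' :=
  ConnectedComponent.supp_injective (congrArg Subgraph.verts h)

theorem inTriangle_iff {V : Type*} {G : SimpleGraph V} {v : V} : InTriangle G v ↔ ∃ w, (triangleGraph G).Adj v w :=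
  ⟨fun ⟨x, y, h1, h2, h3⟩ => ⟨x, h1, y, h2, h3⟩, fun ⟨x, h1, y, h2, h3⟩ => ⟨x, y, h1, h2, h3⟩⟩

variable {V : Type*} [Fintype V] {G : SimpleGraph V} [DecidableRel G.Adj]

theorem IsSubcubic.isNonseparable_supp (hsub : IsSubcubic G) (hconn : G.Connected)
    (hcard : 6 ≤ Fintype.card V) {K : (triangleGraph G).ConnectedComponent}
    (hK : 3 ≤ K.supp.ncard) : IsNonseparable ((⊤ : G.Subgraph).induce K.supp) := by
  rcases hsub.supp_cases hconn hcard K with ⟨v, -, hs⟩ | ⟨a, b, c, hab, hbc, hac, hs⟩ |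
    ⟨x, y, h, k, hhk, hhx, hhy, hkx, hky, -, -, hs⟩
  · rw [hs, Set.ncard_singleton] at hK
    omega
  · rw [hs]
    exact isNonseparable_induce_triangle hab hbc hac
  · rw [hs]
    exact isNonseparable_induce_diamond hhk hhx hhy hkx hky

theorem IsSubcubic.exists_diamond_of_ncard (hsub : IsSubcubic G) (hconn : G.Connected)
    (hcard : 6 ≤ Fintype.card V) {K : (triangleGraph G).ConnectedComponent}
    (hK : K.supp.ncard = 4) : ∃ x y h k, G.Adj h k ∧ G.Adj h x ∧ G.Adj h y ∧ G.Adj k x ∧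
      G.Adj k y ∧ x ≠ y ∧ ¬ G.Adj x y ∧ K.supp = {x, y, h, k} := by
  rcases hsub.supp_cases hconn hcard K with ⟨v, -, hs⟩ | ⟨a, b, c, hab, hbc, hac, hs⟩ | h
  · rw [hs, Set.ncard_singleton] at hK
    omega
  · rw [hs, Set.ncard_eq_three.2 ⟨a, b, c, hab.ne, hac.ne, hbc.ne, rfl⟩] at hK
    omega
  · exact h

theorem IsSubcubic.isK3_supp (hsub : IsSubcubic G) (hconn : G.Connected)
    (hcard : 6 ≤ Fintype.card V) {K : (triangleGraph G).ConnectedComponent} :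
    IsK3 ((⊤ : G.Subgraph).induce K.supp) ↔ K.supp.ncard = 3 := by
  refine ⟨fun h => ncard_verts_of_iso h, fun hK => ?_⟩
  refine nonempty_iso_top_of_complete hK ?_
  rcases hsub.supp_cases hconn hcard K with ⟨v, -, hs⟩ | ⟨a, b, c, hab, hbc, hac, hs⟩ |
    ⟨x, y, h, k, hhk, hhx, hhy, hkx, hky, hne, -, hs⟩
  · rw [hs, Set.ncard_singleton] at hK
    omega
  · intro u hu v hv huv
    refine ⟨hu, hv, ?_⟩
    have hu : u ∈ K.supp := hu
    have hv : v ∈ K.supp := hv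
    have := hab.symm
    have := hbc.symm
    have := hac.symm
    rw [hs] at hu hv
    rcases hu with rfl | rfl | rfl <;> rcases hv with rfl | rfl | rfl <;>
      first | exact (huv rfl).elim | assumption
  · rw [hs, ncard_diamond hhk hhx hhy hkx hky hne] at hK
    omega

theorem IsSubcubic.isDiamond_supp (hsub : IsSubcubic G) (hconn : G.Connected)
    (hcard : 6 ≤ Fintype.card V) {K : (triangleGraph G).ConnectedComponent} :
    IsDiamond ((⊤ : G.Subgraph).induce K.supp) ↔ K.supp.ncard = 4 := by
  refine ⟨fun h => ncard_verts_of_iso h, fun hK => ?_⟩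
  obtain ⟨x, y, h, k, hhk, hhx, hhy, hkx, hky, hne, hxy, hs⟩ :=
    hsub.exists_diamond_of_ncard hconn hcard hK
  rw [hs]
  exact isDiamond_induce hhk hhx hhy hkx hky hne hxy

/-- A block with an edge outside the triangle graph contains a bridge and is just that edge. Any
other block lies within one triangle component, which induces a nonseparable subgraph if it has at
least three vertices, so maximality gives equality. -/
theorem IsSubcubic.block_cases (hsub : IsSubcubic G) (hconn : G.Connected)
    (hcard : 6 ≤ Fintype.card V)
    (hbr : ∀ u v, (G \ triangleGraph G).Adj u v → G.IsBridge s(u, v)) {B : G.Subgraph}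
    (hB : IsBlock B) : (∃ u v, B.Adj u v ∧ B.verts = {u, v}) ∨
      ∃ K : (triangleGraph G).ConnectedComponent, 3 ≤ K.supp.ncard ∧
        B = (⊤ : G.Subgraph).induce K.supp := by
  by_cases hT : ∃ u v, B.Adj u v ∧ ¬ (triangleGraph G).Adj u v
  · obtain ⟨u, v, huv, hT⟩ := hT
    exact Or.inl ⟨u, v, huv, hB.prop.verts_eq_of_isBridge huv (hbr u v ⟨B.adj_sub huv, hT⟩)⟩
  push Not at hT
  obtain ⟨v, hv⟩ := hB.prop.1.nonempty
  have hle : B.verts ⊆ ((triangleGraph G).connectedComponentMk v).supp := fun w hw =>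
    ConnectedComponent.sound <| (hB.prop.1.preconnected.coe ⟨w, hw⟩ ⟨v, hv⟩).map
      ⟨Subtype.val, fun {a b} hab => hT a b hab⟩
  have hcases := hsub.componentWeight_cases hconn hcard ((triangleGraph G).connectedComponentMk v)
  by_cases h3 : 3 ≤ ((triangleGraph G).connectedComponentMk v).supp.ncard
  · exact Or.inr ⟨_, h3, hB.eq_of_le (hsub.isNonseparable_supp hconn hcard h3) (le_induce_top hle)⟩
  · exfalso
    rcases hcases with ⟨z, -, hs, -⟩ | h | h
    · rw [hs] at hle
      obtain rfl : v = z := hle hv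
      -- A one-vertex block is not maximal: some neighbor extends it to a `K_2`.
      have : Nontrivial V := Fintype.one_lt_card_iff_nontrivial.1 (by omega)
      obtain ⟨w, hw⟩ := hconn.preconnected.exists_adj_of_nontrivial v
      have hBw : B.verts ⊆ {v, w} := hle.trans (by simp)
      have h1 := hB.le_of_ge (isNonseparable_induce_pair hw) (le_induce_top hBw)
      exact hw.ne (hle (h1.1 (by simp) : w ∈ B.verts) : w = v).symm
    · omega
    · omega

theorem IsSubcubic.isBlock_supp (hsub : IsSubcubic G) (hconn : G.Connected)
    (hcard : 6 ≤ Fintype.card V)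
    (hbr : ∀ u v, (G \ triangleGraph G).Adj u v → G.IsBridge s(u, v))
    {K : (triangleGraph G).ConnectedComponent} (hK : 3 ≤ K.supp.ncard) :
    IsBlock ((⊤ : G.Subgraph).induce K.supp) := by
  obtain ⟨B, hle, hB⟩ := exists_isBlock_le (hsub.isNonseparable_supp hconn hcard hK)
  have hv : K.supp ⊆ B.verts := hle.1
  rcases hsub.block_cases hconn hcard hbr hB with ⟨u, v, -, hs⟩ | ⟨K', -, rfl⟩
  · rw [hs] at hv
    have := Set.ncard_le_ncard hv (Set.toFinite _)
    have := Set.ncard_insert_le u {v}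
    rw [Set.ncard_singleton] at this
    omega
  · obtain ⟨v, hvK⟩ := K.nonempty_supp
    rwa [ConnectedComponent.eq_of_common_vertex hvK (hv hvK)]

/-- Turns the block counts in the type into counts of triangle components; the bound in `hP`
discards the blocks that are single bridges. -/
theorem IsSubcubic.ncard_blocks (hsub : IsSubcubic G) (hconn : G.Connected)
    (hcard : 6 ≤ Fintype.card V)
    (hbr : ∀ u v, (G \ triangleGraph G).Adj u v → G.IsBridge s(u, v)) {P : G.Subgraph → Prop}
    (hP : ∀ B, P B → 3 ≤ B.verts.ncard) :
    {B : G.Subgraph | IsBlock B ∧ P B}.ncard =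
      {K : (triangleGraph G).ConnectedComponent | P ((⊤ : G.Subgraph).induce K.supp)}.ncard := by
  rw [← Set.ncard_image_of_injective (f := fun K : (triangleGraph G).ConnectedComponent =>
    (⊤ : G.Subgraph).induce K.supp) _ fun K K' h => supp_eq_of_induce_eq h]
  congr 1
  ext B
  constructor
  · rintro ⟨hB, hPB⟩
    rcases hsub.block_cases hconn hcard hbr hB with ⟨u, v, -, hs⟩ | ⟨K, -, rfl⟩
    · have := hP B hPB
      rw [hs] at this
      have := Set.ncard_insert_le u {v}
      rw [Set.ncard_singleton] at this
      omega
    · exact ⟨K, hPB, rfl⟩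
  · rintro ⟨K, hK, rfl⟩
    exact ⟨hsub.isBlock_supp hconn hcard hbr (hP _ hK), hK⟩

theorem IsSubcubic.numDiamondBlocks_eq (hsub : IsSubcubic G) (hconn : G.Connected)
    (hcard : 6 ≤ Fintype.card V)
    (hbr : ∀ u v, (G \ triangleGraph G).Adj u v → G.IsBridge s(u, v)) :
    numDiamondBlocks G =
      {K : (triangleGraph G).ConnectedComponent | K.supp.ncard = 4}.ncard := by
  rw [numDiamondBlocks, hsub.ncard_blocks hconn hcard hbr fun B hB => ?_]
  · simp only [hsub.isDiamond_supp hconn hcard]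
  · rw [ncard_verts_of_iso hB]
    omega

theorem IsSubcubic.numTriangleBlocks_eq (hsub : IsSubcubic G) (hconn : G.Connected)
    (hcard : 6 ≤ Fintype.card V)
    (hbr : ∀ u v, (G \ triangleGraph G).Adj u v → G.IsBridge s(u, v)) (j : ℕ) :
    numTriangleBlocks G j = {K : (triangleGraph G).ConnectedComponent |
      K.supp.ncard = 3 ∧ numCubic G K.supp = j}.ncard := by
  rw [numTriangleBlocks, hsub.ncard_blocks hconn hcard hbr fun B hB => ?_]
  · simp only [hsub.isK3_supp hconn hcard]
    rfl
  · rw [ncard_verts_of_iso hB.1]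

/-- The block around a non-bridge has a third vertex, so it is a triangle or a diamond. Every edge
of either lies in a triangle, contrary to the choice of the edge. -/
theorem MemB0.isBridge (h : MemB0 G) {u v : V} (huv : (G \ triangleGraph G).Adj u v) :
    G.IsBridge s(u, v) := by
  by_contra hb
  obtain ⟨H, hH, hHuv, w, hw, hwu, hwv⟩ := exists_isNonseparable_of_not_isBridge huv.1 hb
  obtain ⟨B, hle, hB⟩ := exists_isBlock_le hH
  have hBuv : B.Adj u v := hle.2 hHuv
  rcases h.blocks B hB with h2 | ⟨⟨f⟩⟩ | ⟨⟨f⟩⟩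
  · have h3 : ({w, u, v} : Set V) ⊆ B.verts := by
      rintro z (rfl | rfl | rfl)
      exacts [hle.1 hw, B.edge_vert hBuv, B.edge_vert hBuv.symm]
    have := Set.ncard_le_ncard h3 (Set.toFinite _)
    rw [ncard_verts_of_iso h2, Set.ncard_eq_three.2 ⟨w, u, v, hwu, hwv, huv.ne, rfl⟩] at this
    omega
  · exact huv.2 (triangleGraph_adj_of_iso f (by simp only [top_adj]; decide) hBuv)
  · refine huv.2 (triangleGraph_adj_of_iso f ?_ hBuv)
    simp only [diamond, deleteEdges_adj, top_adj, Set.mem_singleton_iff]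
    decide

theorem MemB0.isCutVertex_of_diamond (hG : MemB0 G) {x y h k : V}
    (hhk : G.Adj h k) (hhx : G.Adj h x) (hkx : G.Adj k x) (hxy : ¬ G.Adj x y)
    (hs : ((triangleGraph G).connectedComponentMk x).supp = {x, y, h, k})
    (hd : G.degree x = 3) : IsCutVertex G x := by
  classical
  obtain ⟨z, hz, hzh, hzk⟩ : ∃ z, G.Adj x z ∧ z ≠ h ∧ z ≠ k := by
    by_contra! hcon
    have : G.neighborFinset x ⊆ {h, k} := by
      intro z hz
      rw [mem_neighborFinset] at hz
      by_cases e : z = h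
      · simp [e]
      · simp [hcon z hz e]
    have := Finset.card_le_card this
    rw [card_neighborFinset_eq_degree, Finset.card_pair hhk.ne] at this
    omega
  refine isCutVertex_of_isBridge (hG.isBridge ⟨hz, fun hT => ?_⟩) hz hhx.symm hzh.symm
  have hm : z ∈ ((triangleGraph G).connectedComponentMk x).supp :=
    mem_supp_of_triangleGraph_adj (ConnectedComponent.connectedComponentMk_mem) hT
  rw [hs] at hm
  rcases hm with rfl | rfl | rfl | rfl
  · exact hz.ne rfl
  · exact hxy hz
  · exact hzh rfl
  · exact hzk rfl

/-- If all four vertices are cubic, each of the two nonadjacent ends carries a bridge leaving the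
diamond. Both are then cut vertices, and the diamond is not an endblock. -/
theorem MemB0.numCubic_le_three (hG : MemB0 G) {K : (triangleGraph G).ConnectedComponent}
    (hK : K.supp.ncard = 4) : numCubic G K.supp ≤ 3 := by
  have hbr : ∀ u v, (G \ triangleGraph G).Adj u v → G.IsBridge s(u, v) :=
    fun u v huv => hG.isBridge huv
  obtain ⟨x, y, h, k, hhk, hhx, hhy, hkx, hky, hne, hxy, hs⟩ :=
    hG.subcubic.exists_diamond_of_ncard hG.connected hG.order hK
  by_contra hcub
  have hall : {v : V | v ∈ K.supp ∧ G.degree v = 3} = K.supp :=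
    Set.eq_of_subset_of_ncard_le (fun v hv => hv.1) (by rw [numCubic] at hcub; omega)
      (Set.toFinite _)
  have hdeg : ∀ v ∈ K.supp, G.degree v = 3 := fun v hv => by
    rw [← hall] at hv
    exact hv.2
  have hx : x ∈ K.supp := by simp [hs]
  have hy : y ∈ K.supp := by simp [hs]
  have hend := hG.diamonds _
    (hG.subcubic.isBlock_supp hG.connected hG.order hbr (K := K) (by omega))
    ((hG.subcubic.isDiamond_supp hG.connected hG.order).2 hK)
  refine hne (hend.2 ⟨hx, ?_⟩ ⟨hy, ?_⟩)
  · refine hG.isCutVertex_of_diamond hhk hhx hkx hxy ?_ (hdeg x hx)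
    rw [show (triangleGraph G).connectedComponentMk x = K from hx, hs]
  · refine hG.isCutVertex_of_diamond (y := x) hhk hhy hky (fun e => hxy e.symm) ?_ (hdeg y hy)
    rw [show (triangleGraph G).connectedComponentMk y = K from hy, hs, Set.insert_comm]

/-- The two central vertices are never cut vertices, and an end can be one only if it is cubic. Two
cut vertices would therefore make all four vertices cubic. -/
theorem IsSubcubic.isEndblock_of_diamond (hsub : IsSubcubic G) (hconn : G.Connected)
    (hcard : 6 ≤ Fintype.card V)
    (hbr : ∀ u v, (G \ triangleGraph G).Adj u v → G.IsBridge s(u, v))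
    {K : (triangleGraph G).ConnectedComponent} (hK : K.supp.ncard = 4)
    (hcub : numCubic G K.supp ≤ 3) : IsEndblock ((⊤ : G.Subgraph).induce K.supp) := by
  refine ⟨hsub.isBlock_supp hconn hcard hbr (by omega), ?_⟩
  obtain ⟨x, y, h, k, hhk, hhx, hhy, hkx, hky, hne, hxy, hs⟩ :=
    hsub.exists_diamond_of_ncard hconn hcard hK
  have hh : ¬ IsCutVertex G h := not_isCutVertex hconn hhk.ne.symm fun a ha => by
    rcases hsub.eq_or_eq_or_eq hhx hhy hhk hne hkx.ne.symm hky.ne.symm ha with rfl | rfl | rfl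
    exacts [Or.inr hkx.symm, Or.inr hky.symm, Or.inl rfl]
  have hk : ¬ IsCutVertex G k := not_isCutVertex hconn hhk.ne fun a ha => by
    rcases hsub.eq_or_eq_or_eq hkx hky hhk.symm hne hhx.ne.symm hhy.ne.symm ha with
      rfl | rfl | rfl
    exacts [Or.inr hhx.symm, Or.inr hhy.symm, Or.inl rfl]
  have hcut : ∀ {x}, G.Adj h x → G.Adj k x → IsCutVertex G x → G.degree x = 3 := by
    intro x hhx hkx hx
    by_contra hd
    refine not_isCutVertex hconn hhx.ne (fun a ha => ?_) hx
    by_cases hah : a = h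
    · exact Or.inl hah
    by_cases hak : a = k
    · rw [hak]
      exact Or.inr hhk.symm
    · exact (hd (hsub.degree_eq_three hhx.symm hkx.symm ha hhk.ne (Ne.symm hah)
        (Ne.symm hak))).elim
  have hends : ¬ (IsCutVertex G x ∧ IsCutVertex G y) := by
    rintro ⟨hx, hy⟩
    have hdx := hcut hhx hkx hx
    have hdy := hcut hhy hky hy
    have hdh := hsub.degree_of_hub hhk hhx hhy hkx hky hne
    have hdk := hsub.degree_of_hub hhk.symm hkx hky hhx hhy hne
    have hall : {v : V | v ∈ K.supp ∧ G.degree v = 3} = K.supp := by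
      ext v
      refine ⟨fun hv => hv.1, fun hv => ⟨hv, ?_⟩⟩
      rw [hs] at hv
      rcases hv with rfl | rfl | rfl | rfl <;> assumption
    rw [numCubic, hall] at hcub
    omega
  rintro u ⟨hu, hcu⟩ v ⟨hv, hcv⟩
  have hu : u ∈ K.supp := hu
  have hv : v ∈ K.supp := hv
  rw [hs] at hu hv
  rcases hu with rfl | rfl | rfl | rfl <;> rcases hv with rfl | rfl | rfl | rfl <;> tauto

/-- The class `𝓑₀` in terms of the components of the triangle graph. -/
theorem IsSubcubic.memB0_iff (hsub : IsSubcubic G) (hconn : G.Connected)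
    (hcard : 6 ≤ Fintype.card V) :
    MemB0 G ↔ (∀ u v, (G \ triangleGraph G).Adj u v → G.IsBridge s(u, v)) ∧
      (∀ K : (triangleGraph G).ConnectedComponent,
        K.supp.ncard = 4 → numCubic G K.supp ≤ 3) ∧
      ∀ v, (∀ w, ¬ (triangleGraph G).Adj v w) → G.degree v = 3 := by
  constructor
  · intro hG
    refine ⟨fun u v => hG.isBridge, fun K => hG.numCubic_le_three, fun v hv => ?_⟩
    by_contra hd
    have := hsub v
    obtain ⟨w, hw⟩ := inTriangle_iff.1 (hG.inTriangle v (by omega))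
    exact hv w hw
  · rintro ⟨hbr, hcub, hdeg⟩
    refine ⟨hconn, hsub, hcard, fun B hB => ?_, fun B hB hd => ?_, fun v hv => ?_⟩
    · rcases hsub.block_cases hconn hcard hbr hB with ⟨u, v, huv, hs⟩ | ⟨K, hK, rfl⟩
      · refine Or.inl (nonempty_iso_top_of_complete ?_ ?_)
        · rw [hs, Set.ncard_pair huv.ne]
        · rw [hs]
          rintro a (rfl | rfl) b (rfl | rfl) hab <;>
            first | exact (hab rfl).elim | exact huv | exact huv.symm
      · rw [hsub.isK3_supp hconn hcard, hsub.isDiamond_supp hconn hcard]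
        rcases hsub.componentWeight_cases hconn hcard K with ⟨v, -, hs, -⟩ | h | h
        · rw [hs, Set.ncard_singleton] at hK
          omega
        · exact Or.inr (Or.inl h.1)
        · exact Or.inr (Or.inr h.1)
    · rcases hsub.block_cases hconn hcard hbr hB with ⟨u, v, huv, hs⟩ | ⟨K, hK, rfl⟩
      · have := ncard_verts_of_iso hd
        rw [hs, Set.ncard_pair huv.ne] at this
        omega
      · have hK4 := (hsub.isDiamond_supp hconn hcard).1 hd
        exact hsub.isEndblock_of_diamond hconn hcard hbr hK4 (hcub K hK4)
    · rw [inTriangle_iff]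
      by_contra! h
      have := hdeg v h
      omega

end Blocks

/-! ### The excess and the equality case -/

section Excess

variable {V : Type*} [Fintype V] {G : SimpleGraph V} [DecidableRel G.Adj]

theorem IsSubcubic.componentWeight_nonpos (hsub : IsSubcubic G) (hconn : G.Connected)
    (hcard : 6 ≤ Fintype.card V) (K : (triangleGraph G).ConnectedComponent) :
    componentWeight G K ≤ 0 := by
  rcases hsub.componentWeight_cases hconn hcard K with ⟨v, -, -, h⟩ | ⟨-, h1, -, h⟩ |
    ⟨-, -, -, h⟩ <;> rw [h]
  · have : (G.degree v : ℚ) ≤ 3 := by exact_mod_cast hsub v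
    linarith
  · have : (1 : ℚ) ≤ numCubic G K.supp := by exact_mod_cast h1
    linarith
  · have : (0 : ℚ) ≤ numCubic G K.supp := by positivity
    linarith

theorem sum_indicator_eq_ncard {α : Type*} [Fintype α] (p : α → Prop) [DecidablePred p] :
    ∑ a, (if p a then (1 : ℚ) else 0) = ({a | p a}.ncard : ℚ) := by
  rw [Finset.sum_boole, ← Set.ncard_coe_finset]
  simp

theorem IsSubcubic.sum_componentWeight (hsub : IsSubcubic G) (hconn : G.Connected)
    (hcard : 6 ≤ Fintype.card V) [Fintype (triangleGraph G).ConnectedComponent] (hG : MemB0 G) :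
    ∑ K : (triangleGraph G).ConnectedComponent, componentWeight G K =
      - (3 * (numDiamondBlocks G : ℚ) + numTriangleBlocks G 2 + 2 * numTriangleBlocks G 3) := by
  classical
  obtain ⟨hbr, hcub, hdeg⟩ := (hsub.memB0_iff hconn hcard).1 hG
  rw [hsub.numDiamondBlocks_eq hconn hcard hbr, hsub.numTriangleBlocks_eq hconn hcard hbr,
    hsub.numTriangleBlocks_eq hconn hcard hbr, ← sum_indicator_eq_ncard, ← sum_indicator_eq_ncard,
    ← sum_indicator_eq_ncard, Finset.mul_sum, Finset.mul_sum, ← Finset.sum_add_distrib,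
    ← Finset.sum_add_distrib, ← Finset.sum_neg_distrib]
  refine Finset.sum_congr rfl fun K _ => ?_
  rcases hsub.componentWeight_cases hconn hcard K with ⟨v, hv, hs, h⟩ | ⟨hK, h1, h3, h⟩ |
    ⟨hK, h3, -, h⟩
  · rw [h, hdeg v hv, hs, Set.ncard_singleton]
    norm_num
  · rw [h, hK]
    obtain hj | hj | hj :
        numCubic G K.supp = 1 ∨ numCubic G K.supp = 2 ∨ numCubic G K.supp = 3 := by
      omega
    all_goals
      rw [hj]
      norm_num
  · rw [h, hK, le_antisymm (hcub K hK) h3]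
    norm_num

theorem IsSubcubic.excess_le (hsub : IsSubcubic G) (hconn : G.Connected)
    (hcard : 6 ≤ Fintype.card V) :
    12 * ∑ v, vertexCoeff G v - 7 * (Fintype.card V : ℚ) ≤ 14 := by
  have := Fintype.ofFinite (triangleGraph G).ConnectedComponent
  rw [sum_vertexCoeff_eq]
  have h1 : (Nat.card (triangleGraph G).ConnectedComponent : ℚ) ≤
      (G \ triangleGraph G).edgeSet.ncard + 1 := by
    exact_mod_cast card_connectedComponent_le hconn (triangleGraph G)
  have h2 : ∑ K : (triangleGraph G).ConnectedComponent, componentWeight G K ≤ 0 :=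
    Finset.sum_nonpos fun K _ => hsub.componentWeight_nonpos hconn hcard K
  linarith

/-- With c ≤ m the excess would be at most 0, so c = m + 1 and the outside edges are bridges. The
nonpositive weights then sum to at least -3, which rules out a diamond with four cubic vertices
(weight -4) and a triangle-free vertex of degree at most 2 (weight at most -7). -/
theorem IsSubcubic.memB0_of_excess (hsub : IsSubcubic G) (hconn : G.Connected)
    (hcard : 6 ≤ Fintype.card V)
    (h : 11 ≤ 12 * ∑ v, vertexCoeff G v - 7 * (Fintype.card V : ℚ)) : MemB0 G := by
  have := Fintype.ofFinite (triangleGraph G).ConnectedComponent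
  rw [sum_vertexCoeff_eq] at h
  have h1 : (Nat.card (triangleGraph G).ConnectedComponent : ℚ) ≤
      (G \ triangleGraph G).edgeSet.ncard + 1 := by
    exact_mod_cast card_connectedComponent_le hconn (triangleGraph G)
  have hnp := hsub.componentWeight_nonpos hconn hcard
  have h2 : ∑ K : (triangleGraph G).ConnectedComponent, componentWeight G K ≤ 0 :=
    Finset.sum_nonpos fun K _ => hnp K
  have h3 : (G \ triangleGraph G).edgeSet.ncard + 1 ≤
      Nat.card (triangleGraph G).ConnectedComponent := by
    by_contra! h3
    have : (Nat.card (triangleGraph G).ConnectedComponent : ℚ) ≤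
        (G \ triangleGraph G).edgeSet.ncard := by exact_mod_cast Nat.lt_succ_iff.1 h3
    linarith
  have h4 : ∀ K, -3 ≤ componentWeight G K := fun K => by
    have := Finset.single_le_sum (f := fun K => -componentWeight G K)
      (fun K _ => neg_nonneg.2 (hnp K)) (Finset.mem_univ K)
    rw [Finset.sum_neg_distrib] at this
    linarith
  refine (hsub.memB0_iff hconn hcard).2
    ⟨fun u v huv => isBridge_of_card_connectedComponent hconn h3 huv, fun K hK => ?_,
      fun v hv => ?_⟩
  · have h5 := h4 K
    rcases hsub.componentWeight_cases hconn hcard K with ⟨v, -, hs, -⟩ | ⟨hK', -⟩ | ⟨-, -, -, h⟩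
    · rw [hs, Set.ncard_singleton] at hK
      omega
    · omega
    · rw [h] at h5
      have : (numCubic G K.supp : ℚ) ≤ 3 := by linarith
      exact_mod_cast this
  · have h5 := h4 ((triangleGraph G).connectedComponentMk v)
    have hs : ((triangleGraph G).connectedComponentMk v).supp = (({v} : Finset V) : Set V) := by
      rw [Finset.coe_singleton]
      refine supp_connectedComponentMk_eq (by simp) (by simp) ?_
      rintro w rfl z hz
      exact (hv z hz).elim
    rw [componentWeight_eq hs, Finset.sum_singleton, vertexWeight_of_no_triangle hv] at h5
    refine le_antisymm (hsub v) ?_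
    by_contra! hlt
    have : (G.degree v : ℚ) ≤ 2 := by exact_mod_cast Nat.lt_succ_iff.1 hlt
    linarith

theorem MemB0.excess_eq (hG : MemB0 G) :
    12 * ∑ v, vertexCoeff G v - 7 * (Fintype.card V : ℚ) =
      14 - (3 * (numDiamondBlocks G : ℚ) + numTriangleBlocks G 2 + 2 * numTriangleBlocks G 3) := by
  have := Fintype.ofFinite (triangleGraph G).ConnectedComponent
  rw [sum_vertexCoeff_eq, hG.subcubic.sum_componentWeight hG.connected hG.order hG]
  have h : (Nat.card (triangleGraph G).ConnectedComponent : ℚ) =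
      (G \ triangleGraph G).edgeSet.ncard + 1 := by
    exact_mod_cast le_antisymm (card_connectedComponent_le hG.connected (triangleGraph G))
      (card_edgeSet_sdiff_add_one_le hG.connected (fun u v => hG.isBridge) triangleGraph_le)
  rw [h]
  ring

theorem IsSubcubic.memB_iff_excess (hsub : IsSubcubic G) (hconn : G.Connected)
    (hcard : 6 ≤ Fintype.card V) :
    MemB G ↔ 11 ≤ 12 * ∑ v, vertexCoeff G v - 7 * (Fintype.card V : ℚ) := by
  have key : ∀ hG : MemB0 G, (11 ≤ 12 * ∑ v, vertexCoeff G v - 7 * (Fintype.card V : ℚ)) ↔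
      3 * numDiamondBlocks G + numTriangleBlocks G 2 + 2 * numTriangleBlocks G 3 ≤ 3 := by
    intro hG
    rw [hG.excess_eq, ← Nat.cast_le (α := ℚ)]
    push_cast
    constructor <;> intro h <;> linarith
  have htype : graphType G ∈
      ({(0, 0, 0), (1, 0, 0), (0, 1, 0), (0, 0, 1), (0, 1, 1), (0, 2, 0), (0, 3, 0)} :
        Set (ℕ × ℕ × ℕ)) ↔
      3 * numDiamondBlocks G + numTriangleBlocks G 2 + 2 * numTriangleBlocks G 3 ≤ 3 := by
    -- The seven triples are exactly the natural solutions of 3d + i₂ + 2i₃ ≤ 3.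
    simp only [graphType, Set.mem_insert_iff, Set.mem_singleton_iff, Prod.mk.injEq]
    omega
  rw [MemB, htype]
  constructor
  · rintro ⟨hG, h⟩
    exact (key hG).2 h
  · intro h
    have hG := hsub.memB0_of_excess hconn hcard h
    exact ⟨hG, (key hG).1 h⟩

/-- The denominator is 1 for degree 2 and 3 for degree 3. Hence 12 ∑ C_u is a multiple of 4, which
fixes the excess modulo 4. -/
theorem IsSubcubic.exists_three_mul_vertexCoeff (hsub : IsSubcubic G) (v : V) :
    ∃ t : ℤ, 3 * vertexCoeff G v = t := by
  rw [vertexCoeff]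
  split_ifs with h
  · obtain hd | hd : G.degree v = 2 ∨ G.degree v = 3 := by
      have := hsub v
      omega
    · rw [hd]
      exact ⟨3 * ((G.induce (G.neighborSet v)).edgeSet.ncard : ℤ), by norm_num⟩
    · rw [hd]
      refine ⟨((G.induce (G.neighborSet v)).edgeSet.ncard : ℤ), ?_⟩
      norm_num [Nat.choose]
      ring
  · exact ⟨0, by norm_num⟩

/-- Since the excess is an integer congruent to `n` modulo `4`, the bound is attained as soon as
the excess is at least `11`. -/
theorem IsSubcubic.coeff_eq_bound_iff (hsub : IsSubcubic G) (hconn : G.Connected)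
    (hcard : 6 ≤ Fintype.card V) :
    coeff G = bound (Fintype.card V) ↔
      11 ≤ 12 * ∑ v, vertexCoeff G v - 7 * (Fintype.card V : ℚ) := by
  have hle := hsub.excess_le hconn hcard
  choose t ht using hsub.exists_three_mul_vertexCoeff
  have hs : 12 * ∑ v, vertexCoeff G v = ((4 * ∑ v, t v : ℤ) : ℚ) := by
    push_cast
    simp only [← ht]
    rw [← Finset.mul_sum]
    ring
  have hn0 : (Fintype.card V : ℚ) ≠ 0 := by
    have : Fintype.card V ≠ 0 := by omega
    exact_mod_cast this
  have hcoeff : coeff G = ((4 * ∑ v, t v : ℤ) : ℚ) / (12 * (Fintype.card V : ℚ)) := by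
    rw [coeff, ← hs]
    field_simp
  have hbound : bound (Fintype.card V) = ((7 * (Fintype.card V : ℤ) +
      (if Fintype.card V % 4 = 0 then 12 else if Fintype.card V % 4 = 1 then 13
        else if Fintype.card V % 4 = 2 then 14 else 11) : ℤ) : ℚ) /
        (12 * (Fintype.card V : ℚ)) := by
    rw [bound]
    split_ifs <;> push_cast <;> field_simp
  rw [hs] at hle ⊢
  rw [hcoeff, hbound, div_left_inj' (by positivity), Int.cast_inj]
  generalize ∑ v, t v = s at hle ⊢
  generalize Fintype.card V = n at hle ⊢
  have hle' : 4 * s - 7 * (n : ℤ) ≤ 14 := by exact_mod_cast hle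
  have hiff : (11 : ℚ) ≤ ((4 * s : ℤ) : ℚ) - 7 * (n : ℚ) ↔ 11 ≤ 4 * s - 7 * (n : ℤ) := by
    exact_mod_cast Iff.rfl
  rw [hiff]
  -- Since -7n ≡ n modulo 4, the upper bound 14 leaves one possible value of at least 11 in each
  -- residue class: 12, 13, 14 or 11.
  split_ifs <;> omega

end Excess

end Clustering

theorem theorem3 {V : Type*} [Fintype V] (G : SimpleGraph V) [DecidableRel G.Adj]
    (hconn : G.Connected) (hsub : Clustering.IsSubcubic G) (hcard : 6 ≤ Fintype.card V) :
    Clustering.coeff G = Clustering.bound (Fintype.card V) ↔ Clustering.MemB G :=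
  (hsub.coeff_eq_bound_iff hconn hcard).trans (hsub.memB_iff_excess hconn hcard).symm
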